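/- **Conventions.** All actions are by isometries. For $\delta>0$, a (nonempty) geodesic metric space $(S,d)$ is $\delta$-hyperbolic if each side of every geodesic triangle lies in the closed $\delta$-neighbourhood of the union of the other two sides. For an isometry $g$, $\tau(g)=\lim_{n}\frac1n d(x,g^nx)$ (independent of $x\in S$), and $g$ is loxodromic if $\tau(g)>0$. An action of a group $\Gamma$ on $S$ is acylindrical with parameters $R(\cdot),N(\cdot)$ if for every $r>0$ and all $x,x'\in S$ with $d(x,x')\ge R(r)$ there are at most $N(r)$ elements $g\in\Gamma$ with $d(x,gx)\le r$ and $d(x',gx')\le r$. An element $a\in\Gamma$ is achiral if $a^m$ is conjugate to $a^{-m}$ for some $m\ge1$, and chiral otherwise. For a symmetric subset $A\subset\Gamma$ (i.e. $A^{-1}=A$) and $g\in\langle A\rangle$, let $\nu_A(g)$ be the least number of elements of $A$ whose product is $g$, and $\overline{\nu_A}(g)=\lim_n\nu_A(g^n)/n$. For $g\in\Gamma$ put $\overline{\nu_A}(g)=\overline{\nu_A}(g^m)/m$ if $g^m\in\langle A\rangle$ for some $m\ge1$, and $\overline{\nu_A}(g)=\infty$ if there is no such $m$. For a rectifiable path $w$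 in $S$ of length $|w|$, a real $W$ with $0<W<|w|$ and $x,y\in S$, let $$c_{w,W}(x,y)=d(x,y)-\inf_\alpha\bigl(|\alpha|-W|\alpha|_w\bigr),$$ where $\alpha$ runs over the rectifiable paths from $x$ to $y$ and $|\alpha|_w$ is the maximal number of non-overlapping subpaths of $\alpha$ of the form $\gamma w$ with $\gamma\in\Gamma$ (paths being parametrized by arc length; consecutive copies may share an endpoint). For $x_0\in S$ and $a\in\Gamma$ let $$h_{w,W,x_0}(a)=c_{w,W}(x_0,ax_0)-c_{w^{-1},W}(x_0,ax_0),\qquad \overline{h}(a)=\lim_n h(a^n)/n .$$ **Theorem.** Let $\delta>0$. (0) There are constants $T,K>0$ such that for every action of a group $\Gamma$ on a $\delta$-hyperbolic space $S$, every $g\in\Gamma$ with $\tau(g)\ge T$, every $x\in S$ with $d(x,gx)-\inf_{z\in S}d(z,gz)\le\delta$ and every integer $i\ge0$, $$i\,\tau(g)\le d(x,g^ix)\le i\,\tau(g)+K. \qquad(*)$$ Fix any $T,K>0$ with property $(*)$, and functions $R:\mathbb R\to\mathbb R$, $N:\mathbb R\to\mathbb Z_{\ge0}$. Then there is $M\in\mathbb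 Z_{>0}$, depending only on $\delta,T,K,R,N$, such that the following holds for every group $\Gamma$ acting on a $\delta$-hyperbolic space $S$ acylindrically with parameters $R,N$. For $g\in\Gamma$ chiral loxodromic, write $h_{g^M}=h_{w,K+1,x_0}$, where $x_0\in S$ is any point such that $d(x_0,g^mx_0)-\inf_{z}d(z,g^mz)\le\delta$ for some positive divisor $m$ of $M$ with $\tau(g^m)\ge\max\{T,2K+2\}$, and $w$ is any geodesic from $x_0$ to $g^Mx_0$. (1) For every chiral loxodromic $g\in\Gamma$ we have $\tau(g^M)\ge\max\{T,2K+2\}$, and $\overline{h_{g^M}}(g)\ge\frac1M$ for every such choice of $x_0$ and $w$. (2) Let $A\subset\Gamma$ be a symmetric subset containing every element of finite order. Choose $x_0$ and $w$ as above for each chiral loxodromic $g\in\Gamma$, and suppose that there is a constant $C>0$ such that $\sup\{|\overline{h_{g^M}}(a)|: a\in A\}\le C$ for every chiral loxodromic $g\in\Gamma$. Then (i) a loxodromic element $g\in\Gamma$ is achiral if and only if $\overline{\nu_A}(g)=0$; (ii) there is a constant $\Theta>0$ such that $\overline{\nu_A}(g)\ge\Theta$ for every chiral loxodromic element $g\in\Gamma$.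 -/

import Mathlib

open Filter Topology Set

noncomputable section

namespace GapThm

/-! ### Paths, geodesics, hyperbolic spaces -/

/-- A rectifiable path in a metric space, parametrized by arc length on `[0, len]`.
Only the values of `toFun` on `[0, len]` matter. -/
structure ArcPath (S : Type*) [MetricSpace S] where
  len : ℝ
  toFun : ℝ → S
  len_nonneg : 0 ≤ len
  unit_speed : HasUnitSpeedOn toFun (Icc 0 len)

namespace ArcPath

variable {S : Type*} [MetricSpace S]

/-- The path starts at `x` and ends at `y`. -/
def Joins (p : ArcPath S) (x y : S) : Prop :=
  p.toFun 0 = x ∧ p.toFun p.len = y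

def image (p : ArcPath S) : Set S := p.toFun '' Icc 0 p.len

def IsGeodesic (p : ArcPath S) : Prop :=
  ∀ s ∈ Icc 0 p.len, ∀ t ∈ Icc 0 p.len, dist (p.toFun s) (p.toFun t) = |s - t|

/-- The inverse path `w⁻¹`, i.e. `w` run backwards. -/
def reverse (p : ArcPath S) : ArcPath S where
  len := p.len
  toFun := fun t => p.toFun (p.len - t)
  len_nonneg := p.len_nonneg
  unit_speed := by
    intro x hx y hy
    have h := p.unit_speed (x := p.len - y) ⟨by linarith [hy.2], by linarith [hy.1]⟩
      (y := p.len - x) ⟨by linarith [hx.2], by linarith [hx.1]⟩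
    have e : (fun t => p.len - t) '' (Icc 0 p.len ∩ Icc x y)
        = Icc 0 p.len ∩ Icc (p.len - y) (p.len - x) := by
      ext u
      constructor
      · rintro ⟨t, ⟨⟨h1, h2⟩, h3, h4⟩, rfl⟩
        exact ⟨⟨by simp only; linarith, by simp only; linarith⟩,
          by simp only; linarith, by simp only; linarith⟩
      · rintro ⟨⟨h1, h2⟩, h3, h4⟩
        exact ⟨p.len - u, ⟨⟨by linarith, by linarith⟩, by linarith, by linarith⟩, by simp⟩
    have hc := eVariationOn.comp_eq_of_antitoneOn p.toFun (t := Icc 0 p.len ∩ Icc x y)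
      (fun t => p.len - t) (fun a _ b _ hab => by simp only; linarith)
    rw [e, h] at hc
    have : p.len - x - (p.len - y) = y - x := by ring
    rw [this] at hc
    exact hc

end ArcPath

/-- Each side of the triangle is contained in the closed `δ`-neighbourhood of the union of the
other two sides. -/
def IsSlim {S : Type*} [MetricSpace S] (δ : ℝ) (p q r : ArcPath S) : Prop :=
  p.image ⊆ Metric.cthickening δ (q.image ∪ r.image) ∧
  q.image ⊆ Metric.cthickening δ (r.image ∪ p.image) ∧
  r.image ⊆ Metric.cthickening δ (p.image ∪ q.image)

/-- `δ`-hyperbolic geodesic metric spaces. -/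
structure IsHyperbolic (δ : ℝ) (S : Type*) [MetricSpace S] : Prop where
  geodesic : ∀ x y : S, ∃ p : ArcPath S, p.IsGeodesic ∧ p.Joins x y
  slim : ∀ (x y z : S) (p q r : ArcPath S),
    p.IsGeodesic → q.IsGeodesic → r.IsGeodesic →
    p.Joins x y → q.Joins y z → r.Joins z x → IsSlim δ p q r

/-! ### Isometric actions -/

section Action

variable {Γ : Type*} [Group Γ] {S : Type*} [MetricSpace S] [MulAction Γ S]

variable (S) in
/-- `τ(g) = lim d(x, gⁿ x) / n`; the limit exists and does not depend on the point `x`. -/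
def translationLength [Nonempty S] (g : Γ) : ℝ :=
  limUnder atTop fun n : ℕ =>
    dist (Classical.arbitrary S) (g ^ n • Classical.arbitrary S) / n

variable (S) in
def IsLoxodromic [Nonempty S] (g : Γ) : Prop := 0 < translationLength S g

variable (Γ S) in
/-- The action is acylindrical with parameters `r ↦ (R r, N r)`. -/
def AcylindricalWith (R : ℝ → ℝ) (N : ℝ → ℕ) : Prop :=
  ∀ r : ℝ, 0 < r → ∀ x x' : S, R r ≤ dist x x' →
    {g : Γ | dist x (g • x) ≤ r ∧ dist x' (g • x') ≤ r}.encard ≤ N r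

/-- The displacement of `g` at `x` is within `δ` of its infimum. -/
def AlmostMinimal (δ : ℝ) (g : Γ) (x : S) : Prop :=
  dist x (g • x) - ⨅ z : S, dist z (g • z) ≤ δ

end Action

/-- `T, K > 0` are such that for every isometric action on a `δ`-hyperbolic space, every `g` with
`τ(g) ≥ T`, every point `x` of `δ`-almost minimal displacement and every `i ≥ 0`,
`i τ(g) ≤ d(x, gⁱ x) ≤ i τ(g) + K`. -/
def DisplacementConstants.{u, v} (δ T K : ℝ) : Prop :=
  0 < T ∧ 0 < K ∧
  ∀ (Γ : Type u) [Group Γ] (S : Type v) [MetricSpace S] [Nonempty S] [MulAction Γ S]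
    [IsIsometricSMul Γ S], IsHyperbolic δ S →
    ∀ g : Γ, T ≤ translationLength S g → ∀ x : S, AlmostMinimal δ g x → ∀ i : ℕ,
      i * translationLength S g ≤ dist x (g ^ i • x) ∧
      dist x (g ^ i • x) ≤ i * translationLength S g + K

/-! ### Epstein--Fujiwara quasimorphisms -/

section Counting

variable (Γ : Type*) [Group Γ] {S : Type*} [MetricSpace S] [MulAction Γ S]

/-- `α` contains `n` non-overlapping oriented copies of `w` as subpaths: `s i` is the starting
time in `α` of the copy `g i • w`. Consecutive copies may share an endpoint. -/
def HasCopies (w α : ArcPath S) (n : ℕ) : Prop :=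
  ∃ (s : Fin n → ℝ) (g : Fin n → Γ),
    (∀ i, 0 ≤ s i ∧ s i + w.len ≤ α.len) ∧
    (∀ i, ∀ t ∈ Icc 0 w.len, α.toFun (s i + t) = g i • w.toFun t) ∧
    Pairwise fun i j => w.len ≤ |s i - s j|

/-- `|α|_w`, the maximal number of non-overlapping copies of `w` in `α` (for `|w| > 0`). -/
def copyCount (w α : ArcPath S) : ℕ := sSup {n | HasCopies Γ w α n}

/-- `c_{w,W}([x,y]) = d(x,y) - inf_α (|α| - W |α|_w)`. -/
def countingFunction (w : ArcPath S) (W : ℝ) (x y : S) : ℝ :=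
  dist x y - sInf {b : ℝ | ∃ α : ArcPath S, α.Joins x y ∧ b = α.len - W * copyCount Γ w α}

variable {Γ} in
/-- `h_{w,W,x₀}(a) = c_{w,W}([x₀, a x₀]) - c_{w⁻¹,W}([x₀, a x₀])`. -/
def epsteinFujiwara (w : ArcPath S) (W : ℝ) (x₀ : S) (a : Γ) : ℝ :=
  countingFunction Γ w W x₀ (a • x₀) - countingFunction Γ w.reverse W x₀ (a • x₀)

end Counting

section Groups

variable {Γ : Type*} [Group Γ]

/-- `ψ̄(g) = lim ψ(gⁿ) / n`. -/
def homogenization (ψ : Γ → ℝ) (g : Γ) : ℝ :=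
  limUnder atTop fun n : ℕ => ψ (g ^ n) / n

/-- `a` is achiral if `aᵐ` is conjugate to `a⁻ᵐ` for some `m > 0`. -/
def IsAchiral (a : Γ) : Prop := ∃ m : ℕ, 0 < m ∧ IsConj (a ^ m) (a ^ m)⁻¹

/-- The word norm of `g ∈ ⟨A⟩` with respect to a symmetric set `A`. -/
def wordNorm (A : Set Γ) (g : Γ) : ℕ :=
  sInf {n | ∃ l : List Γ, l.length = n ∧ (∀ a ∈ l, a ∈ A) ∧ l.prod = g}

/-- The stable word norm, for elements of `⟨A⟩`. -/
def stableWordNormAux (A : Set Γ) (g : Γ) : ℝ :=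
  limUnder atTop fun n : ℕ => (wordNorm A (g ^ n) : ℝ) / n

open Classical in
/-- The stable word norm on all of `Γ`: its value at `g` is the stable norm of `gᵐ` divided by `m`
if `gᵐ ∈ ⟨A⟩` for some `m > 0` (the value is independent of `m`; the least one is taken), and `∞`
if there is no such `m`. -/
def stableWordNorm (A : Set Γ) (g : Γ) : ENNReal :=
  if h : ∃ m : ℕ, 0 < m ∧ g ^ m ∈ Subgroup.closure A then
    ENNReal.ofReal (stableWordNormAux A (g ^ Nat.find h) / Nat.find h)
  else ⊤

end Groups

/-- The choices that enter the quasimorphism `h_{g^M}`: `w` is a geodesic from `x₀` to `g^M x₀`,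
where the displacement of `gᵐ` is `δ`-almost minimal at `x₀`, for some divisor `m` of `M` with
`τ(gᵐ) ≥ max {T, 2K + 2}`. -/
def Admissible {Γ : Type*} [Group Γ] {S : Type*} [MetricSpace S] [Nonempty S] [MulAction Γ S]
    (δ T K : ℝ) (M : ℕ) (g : Γ) (x₀ : S) (w : ArcPath S) : Prop :=
  (∃ m : ℕ, m ∣ M ∧ max T (2 * K + 2) ≤ translationLength S (g ^ m) ∧
    AlmostMinimal δ (g ^ m) x₀) ∧
  w.IsGeodesic ∧ w.Joins x₀ (g ^ M • x₀)

end GapThm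

end

universe u v

/-!
A path that almost minimizes `|α| - W |α|_w` is a quasigeodesic with constants depending only on
`W`, so by stability of quasigeodesics it passes near every point that almost lies between its
endpoints. Cutting and concatenating such paths at such a point bounds the defect of `h_{w,W}` in
terms of `δ` and `W` alone.

Let `g` be chiral loxodromic and `w` a geodesic from `x₀` to `g^M x₀`. If `w⁻¹` lowered the cost of
going from `x₀` to `gⁿ x₀`, then an almost minimizing path would contain a copy `γ w⁻¹`, so that `γ`
would reverse the direction of a long segment of the axis of `g`. All the elements
`g⁻ⁱ γ g⁻ⁱ γ⁻¹` with `i` small compared to `M` would then almost fix two distant points; by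
acylindricity two of them agree, and `g` is achiral. Hence only the copies of `w` count, each
period of `g^M` contributes at least `1`, and `h(g^{Mn}) ≥ n`. A Bavard-type inequality turns this
into a lower bound for the stable word norm. Conversely, acylindricity forces an element `t` that
inverts a power `g^m` to have finite order, and `g^{2mn}` is then the product of two elements of
finite order.
-/

noncomputable section

namespace GapThm

section Metric

variable {S : Type*} [MetricSpace S]

/-- Any two points are joined by a geodesic. -/
def GeodesicSpace (S : Type*) [MetricSpace S] : Prop :=
  ∀ x y : S, ∃ p : ArcPath S, p.IsGeodesic ∧ p.Joins x y

/-- The four-point condition for Gromov hyperbolicity. -/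
def FourPoint (Δ : ℝ) (S : Type*) [MetricSpace S] : Prop :=
  ∀ x y z w : S,
    dist x y + dist z w ≤ max (dist x z + dist y w) (dist x w + dist y z) + Δ

/-- The point `p` lies between `x` and `z` up to the additive error `C`; equivalently, the Gromov
product of `x` and `z` at `p` is at most `C / 2`. -/
abbrev AlmostBetween (C : ℝ) (x p z : S) : Prop := dist x p + dist p z ≤ dist x z + C

theorem AlmostBetween.symm {C : ℝ} {x p z : S} (h : AlmostBetween C x p z) :
    AlmostBetween C z p x := by
  unfold AlmostBetween at *
  rw [dist_comm z p, dist_comm p x, dist_comm z x]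
  linarith

theorem AlmostBetween.mono {C D : ℝ} (hCD : C ≤ D) {x p z : S} (h : AlmostBetween C x p z) :
    AlmostBetween D x p z := by
  linarith

namespace FourPoint

variable {Δ : ℝ}

theorem le_or_le (h : FourPoint Δ S) (x y z w : S) :
    dist x y + dist z w ≤ dist x z + dist y w + Δ ∨
      dist x y + dist z w ≤ dist x w + dist y z + Δ := by
  simpa only [← max_add_add_right, le_max_iff] using h x y z w

theorem nonneg [Nonempty S] (h : FourPoint Δ S) : 0 ≤ Δ := by
  obtain ⟨x⟩ := ‹Nonempty S›
  simpa using h x x x x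

theorem almostBetween_of_lt (hΔ : FourPoint Δ S) {C : ℝ} {o p y z : S}
    (hy : AlmostBetween C p y z) (h : dist o p + (C + Δ) < dist o y + dist p y) :
    AlmostBetween (C + Δ) o y z := by
  rcases hΔ.le_or_le o y p z with h' | h' <;> linarith [dist_comm y p]

theorem almostBetween_or (hΔ : FourPoint Δ S) {C : ℝ} {o x o' : S} (hx : AlmostBetween C o x o')
    (y : S) : AlmostBetween (C + Δ) o x y ∨ AlmostBetween (C + Δ) y x o' := by
  unfold AlmostBetween at *
  rcases hΔ.le_or_le o o' x y with h | h
  · right; linarith [dist_comm y o', dist_comm y x]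
  · left; linarith [dist_comm x o']

end FourPoint

namespace ArcPath

theorem dist_le (p : ArcPath S) {s t : ℝ} (hs : s ∈ Icc 0 p.len) (ht : t ∈ Icc 0 p.len) :
    dist (p.toFun s) (p.toFun t) ≤ |s - t| := by
  wlog hst : s ≤ t generalizing s t
  · rw [dist_comm, abs_sub_comm]
    exact this ht hs (le_of_not_ge hst)
  have hvar : edist (p.toFun s) (p.toFun t) ≤ eVariationOn p.toFun (Icc 0 p.len ∩ Icc s t) :=
    eVariationOn.edist_le _ ⟨hs, le_rfl, hst⟩ ⟨ht, hst, le_rfl⟩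
  rw [p.unit_speed hs ht, edist_le_ofReal (by simpa using hst)] at hvar
  rw [abs_sub_comm, abs_of_nonneg (sub_nonneg.2 hst)]
  simpa using hvar

theorem zero_mem (p : ArcPath S) : (0 : ℝ) ∈ Icc 0 p.len := ⟨le_rfl, p.len_nonneg⟩

theorem len_mem (p : ArcPath S) : p.len ∈ Icc 0 p.len := ⟨p.len_nonneg, le_rfl⟩

theorem continuousOn (p : ArcPath S) : ContinuousOn p.toFun (Icc 0 p.len) := by
  have hlip : LipschitzOnWith 1 p.toFun (Icc 0 p.len) :=
    .of_dist_le_mul fun s hs t ht => by simpa [Real.dist_eq] using p.dist_le hs ht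
  exact hlip.continuousOn

theorem mem_cthickening_image_Icc (p : ArcPath S) {a b R : ℝ} (ha : 0 ≤ a) (hb : b ≤ p.len)
    (hR : 0 ≤ R) {z : S} :
    z ∈ Metric.cthickening R (p.toFun '' Icc a b) ↔ ∃ t ∈ Icc a b, dist z (p.toFun t) ≤ R := by
  have hcompact : IsCompact (p.toFun '' Icc a b) :=
    isCompact_Icc.image_of_continuousOn (p.continuousOn.mono (Icc_subset_Icc ha hb))
  simp [hcompact.cthickening_eq_biUnion_closedBall hR]

theorem exists_mem_inter (p : ArcPath S) {A B : Set S} (hA : IsClosed A) (hB : IsClosed B)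
    (hAB : p.image ⊆ A ∪ B) (h0 : p.toFun 0 ∈ A) (hlen : p.toFun p.len ∈ B) :
    ∃ t ∈ Icc 0 p.len, p.toFun t ∈ A ∩ B := by
  have hconn : IsPreconnected p.image := isPreconnected_Icc.image _ p.continuousOn
  obtain ⟨_, ⟨t, ht, rfl⟩, hmem⟩ := isPreconnected_closed_iff.1 hconn A B hA hB hAB
    ⟨_, mem_image_of_mem _ p.zero_mem, h0⟩ ⟨_, mem_image_of_mem _ p.len_mem, hlen⟩
  exact ⟨t, ht, hmem⟩

theorem Joins.dist_le {p : ArcPath S} {x y : S} (h : p.Joins x y) : dist x y ≤ p.len := by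
  simpa [h.1, h.2, abs_of_nonneg p.len_nonneg] using p.dist_le p.zero_mem p.len_mem

theorem Joins.reverse {p : ArcPath S} {x y : S} (h : p.Joins x y) : p.reverse.Joins y x := by
  constructor <;> simp [ArcPath.reverse, h.1, h.2]

namespace IsGeodesic

variable {p : ArcPath S} {x y : S}

theorem len_eq (hp : p.IsGeodesic) (h : p.Joins x y) : p.len = dist x y := by
  simpa [h.1, h.2, abs_of_nonneg p.len_nonneg] using (hp 0 p.zero_mem p.len p.len_mem).symm

theorem dist_left (hp : p.IsGeodesic) (h : p.Joins x y) {t : ℝ} (ht : t ∈ Icc 0 p.len) :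
    dist x (p.toFun t) = t := by
  simpa [h.1, abs_of_nonneg ht.1] using hp 0 p.zero_mem t ht

theorem dist_right (hp : p.IsGeodesic) (h : p.Joins x y) {t : ℝ} (ht : t ∈ Icc 0 p.len) :
    dist (p.toFun t) y = p.len - t := by
  simpa [h.2, abs_sub_comm t, abs_of_nonneg (sub_nonneg.2 ht.2)] using hp t ht p.len p.len_mem

theorem almostBetween_of_mem_cthickening (hp : p.IsGeodesic) (h : p.Joins x y) {δ : ℝ}
    (hδ : 0 ≤ δ) {z : S} (hz : z ∈ Metric.cthickening δ p.image) :
    AlmostBetween (2 * δ) x z y := by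
  obtain ⟨t, ht, hzt⟩ := (p.mem_cthickening_image_Icc le_rfl le_rfl hδ).1 hz
  have hleft := dist_triangle x (p.toFun t) z
  have hright := dist_triangle z (p.toFun t) y
  rw [hp.dist_left h ht] at hleft
  rw [hp.dist_right h ht] at hright
  linarith [hp.len_eq h, dist_comm z (p.toFun t)]

end IsGeodesic

end ArcPath

theorem IsHyperbolic.exists_center {δ : ℝ} (hδ : 0 ≤ δ) (hS : IsHyperbolic δ S) {x y : S}
    {p : ArcPath S} (hp : p.IsGeodesic) (hxy : p.Joins x y) (z : S) :
    ∃ t ∈ Icc 0 p.len,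
      AlmostBetween (2 * δ) x (p.toFun t) z ∧ AlmostBetween (2 * δ) y (p.toFun t) z := by
  obtain ⟨q, hq, hyz⟩ := hS.geodesic y z
  obtain ⟨r, hr, hzx⟩ := hS.geodesic z x
  have hslim := (hS.slim x y z p q r hp hq hr hxy hyz hzx).1
  rw [Metric.cthickening_union, union_comm] at hslim
  obtain ⟨t, ht, hmem⟩ := p.exists_mem_inter Metric.isClosed_cthickening
    Metric.isClosed_cthickening hslim
    (Metric.self_subset_cthickening _ ⟨r.len, r.len_mem, hzx.2.trans hxy.1.symm⟩)
    (Metric.self_subset_cthickening _ ⟨0, q.zero_mem, hyz.1.trans hxy.2.symm⟩)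
  exact ⟨t, ht, (hr.almostBetween_of_mem_cthickening hzx hδ hmem.1).symm,
    hq.almostBetween_of_mem_cthickening hyz hδ hmem.2⟩

theorem IsHyperbolic.fourPoint {δ : ℝ} (hδ : 0 ≤ δ) (hS : IsHyperbolic δ S) :
    FourPoint (4 * δ) S := by
  intro x y z w
  rw [← max_add_add_right, le_max_iff]
  obtain ⟨p, hp, hxy⟩ := hS.geodesic x y
  obtain ⟨s, hs, hxs, hys⟩ := hS.exists_center hδ hp hxy z
  obtain ⟨t, ht, hxt, hyt⟩ := hS.exists_center hδ hp hxy w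
  have hzw := dist_triangle4 z (p.toFun s) (p.toFun t) w
  have hst := hp s hs t ht
  simp only [AlmostBetween, hp.dist_left hxy hs, hp.dist_left hxy ht, dist_comm y (p.toFun _),
    hp.dist_right hxy hs, hp.dist_right hxy ht, dist_comm (p.toFun s) z] at hxs hys hxt hyt
  rcases le_total s t with h | h
  · rw [abs_sub_comm, abs_of_nonneg (sub_nonneg.2 h)] at hst
    right; linarith [hp.len_eq hxy]
  · rw [abs_of_nonneg (sub_nonneg.2 h)] at hst
    left; linarith [hp.len_eq hxy]

namespace FourPoint

variable {Δ : ℝ} {x y : S} {p : ArcPath S}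

theorem exists_center (hΔ : FourPoint Δ S) (hp : p.IsGeodesic) (hxy : p.Joins x y) (z : S) :
    ∃ t ∈ Icc 0 p.len, AlmostBetween Δ x (p.toFun t) z ∧ AlmostBetween Δ y (p.toFun t) z := by
  have hlen := hp.len_eq hxy
  set t := (dist x y + dist x z - dist y z) / 2 with ht_def
  have ht : t ∈ Icc 0 p.len := by
    constructor <;> linarith [dist_triangle y x z, dist_triangle x y z, dist_comm x y]
  have hleft := hp.dist_left hxy ht
  have hright := hp.dist_right hxy ht
  refine ⟨t, ht, ?_⟩
  rcases hΔ.le_or_le z (p.toFun t) x y with h | h <;> constructor <;>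
    linarith [dist_comm z (p.toFun t), dist_comm z x, dist_comm z y, dist_comm x (p.toFun t),
      dist_comm y (p.toFun t)]

theorem exists_dist_le_of_almostBetween (hΔ : FourPoint Δ S) (hp : p.IsGeodesic)
    (hxy : p.Joins x y) {q : S} {C : ℝ} (hC : 0 ≤ C) (hq : AlmostBetween C x q y) :
    ∃ t ∈ Icc 0 p.len, dist q (p.toFun t) ≤ C + Δ := by
  have : Nonempty S := ⟨x⟩
  have hlen := hp.len_eq hxy
  rcases le_total (dist x q) p.len with h | h
  · have ht : dist x q ∈ Icc 0 p.len := ⟨dist_nonneg, h⟩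
    have hleft := hp.dist_left hxy ht
    have hright := hp.dist_right hxy ht
    refine ⟨dist x q, ht, ?_⟩
    rcases hΔ.le_or_le q (p.toFun (dist x q)) x y with h' | h' <;>
      linarith [dist_comm q x, dist_comm (p.toFun (dist x q)) x]
  · refine ⟨p.len, p.len_mem, ?_⟩
    rw [hxy.2]
    linarith [hΔ.nonneg]

end FourPoint

end Metric

theorem tendsto_mul_div {u : ℕ → ℝ} {L : ℝ} (h : Tendsto (fun n : ℕ => u n / n) atTop (𝓝 L))
    (m : ℕ) : Tendsto (fun n : ℕ => u (m * n) / n) atTop (𝓝 (m * L)) := by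
  rcases Nat.eq_zero_or_pos m with rfl | hm
  · simpa using tendsto_const_div_atTop_nhds_zero_nat (u 0)
  refine ((h.comp (tendsto_id.const_mul_atTop' hm)).const_mul (m : ℝ)).congr fun n => ?_
  simp only [Function.comp, id, Nat.cast_mul]
  field_simp

section TranslationLength

variable {Γ : Type*} [Group Γ] {S : Type*} [MetricSpace S] [MulAction Γ S]

theorem AlmostMinimal.dist_le {δ : ℝ} {g : Γ} {x : S} (h : AlmostMinimal δ g x) (z : S) :
    dist x (g • x) ≤ dist z (g • z) + δ := by
  have hinf : (⨅ z : S, dist z (g • z)) ≤ dist z (g • z) :=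
    ciInf_le ⟨0, by rintro _ ⟨n, rfl⟩; positivity⟩ z
  unfold AlmostMinimal at h
  linarith

theorem exists_almostMinimal [Nonempty S] {δ : ℝ} (hδ : 0 < δ) (g : Γ) :
    ∃ x : S, AlmostMinimal δ g x := by
  obtain ⟨x, hx⟩ := exists_lt_of_ciInf_lt
    (show (⨅ z : S, dist z (g • z)) < (⨅ z : S, dist z (g • z)) + δ by linarith)
  exact ⟨x, by unfold AlmostMinimal; linarith⟩

theorem bddBelow_dist_pow_smul_div (g : Γ) (x : S) :
    BddBelow (range fun n : ℕ => dist x (g ^ n • x) / n) :=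
  ⟨0, by rintro _ ⟨n, rfl⟩; positivity⟩

variable [IsIsometricSMul Γ S]

theorem dist_pow_smul_pow_smul (g : Γ) (x : S) (m n : ℕ) :
    dist (g ^ m • x) (g ^ (m + n) • x) = dist x (g ^ n • x) := by
  rw [pow_add, mul_smul, dist_smul]

theorem subadditive_dist_pow_smul (g : Γ) (x : S) :
    Subadditive fun n : ℕ => dist x (g ^ n • x) := fun m n => by
  simpa only [dist_pow_smul_pow_smul] using dist_triangle x (g ^ m • x) (g ^ (m + n) • x)

section Nonempty

variable [Nonempty S]

theorem tendsto_translationLength (g : Γ) (x : S) :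
    Tendsto (fun n : ℕ => dist x (g ^ n • x) / n) atTop (𝓝 (translationLength S g)) := by
  set o := Classical.arbitrary S
  have hlim : Tendsto (fun n : ℕ => dist o (g ^ n • o) / n) atTop (𝓝 (translationLength S g)) :=
    tendsto_nhds_limUnder ⟨_, (subadditive_dist_pow_smul g o).tendsto_lim
      (bddBelow_dist_pow_smul_div g o)⟩
  have hdiff : Tendsto (fun n : ℕ => dist x (g ^ n • x) / n - dist o (g ^ n • o) / n)
      atTop (𝓝 0) := by
    refine squeeze_zero_norm (a := fun n : ℕ => 2 * dist x o / n) (fun n => ?_)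
      (tendsto_const_div_atTop_nhds_zero_nat _)
    rw [← sub_div, norm_div, Real.norm_natCast, Real.norm_eq_abs]
    gcongr
    have hx := dist_triangle4 x o (g ^ n • o) (g ^ n • x)
    have ho := dist_triangle4 o x (g ^ n • x) (g ^ n • o)
    rw [dist_smul] at hx ho
    rw [abs_le]
    constructor <;> linarith [dist_comm x o]
  simpa using hdiff.add hlim

theorem mul_translationLength_le (g : Γ) (x : S) (n : ℕ) :
    n * translationLength S g ≤ dist x (g ^ n • x) := by
  rcases eq_or_ne n 0 with rfl | hn
  · simp
  have hsub := subadditive_dist_pow_smul g x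
  have hbdd := bddBelow_dist_pow_smul_div g x
  rw [tendsto_nhds_unique (tendsto_translationLength g x) (hsub.tendsto_lim hbdd), mul_comm,
    ← le_div_iff₀ (by positivity)]
  exact hsub.lim_le_div hbdd hn

theorem le_translationLength {g : Γ} {x : S} {c : ℝ}
    (h : ∀ n : ℕ, n * c ≤ dist x (g ^ n • x)) : c ≤ translationLength S g := by
  refine ge_of_tendsto (tendsto_translationLength g x) ?_
  filter_upwards [eventually_gt_atTop 0] with n hn
  rw [le_div_iff₀ (by positivity), mul_comm]
  exact h n

theorem translationLength_nonneg (g : Γ) : 0 ≤ translationLength S g :=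
  le_translationLength (x := Classical.arbitrary S) (by simp)

theorem translationLength_pow (g : Γ) (m : ℕ) :
    translationLength S (g ^ m) = m * translationLength S g := by
  let x := Classical.arbitrary S
  refine tendsto_nhds_unique (tendsto_translationLength (g ^ m) x) ?_
  simpa only [pow_mul] using tendsto_mul_div (tendsto_translationLength g x) m

end Nonempty

theorem AlmostMinimal.two_mul_dist_le {δ Δ : ℝ} (hgeo : GeodesicSpace S) (hΔ : FourPoint Δ S)
    {g : Γ} {x : S} (h : AlmostMinimal δ g x) (hL : δ + 2 * Δ < dist x (g • x)) :
    2 * dist x (g • x) ≤ dist x (g ^ 2 • x) + (δ + 2 * Δ) := by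
  have : Nonempty S := ⟨x⟩
  obtain ⟨p, hp, hj⟩ := hgeo x (g • x)
  have hlen := hp.len_eq hj
  have ht : p.len / 2 ∈ Icc 0 p.len := ⟨by linarith [p.len_nonneg], by linarith [p.len_nonneg]⟩
  have hleft := hp.dist_left hj ht
  have hright := hp.dist_right hj ht
  -- The displacement of `g` at the midpoint `q` would be too small if the orbit turned back.
  set q := p.toFun (p.len / 2)
  have hq := h.dist_le q
  have hgq : dist (g • x) (g • q) = dist x q := dist_smul _ _ _
  have hgq' : dist (g • q) (g ^ 2 • x) = dist q (g • x) := by rw [pow_two, mul_smul, dist_smul]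
  have hgx : dist (g • x) (g ^ 2 • x) = dist x (g • x) := by rw [pow_two, mul_smul, dist_smul]
  have hfour : dist x (g • x) + dist q (g • q) ≤ dist x (g • q) + dist (g • x) q + Δ := by
    rcases hΔ.le_or_le x (g • x) q (g • q) with h | h <;> linarith [hΔ.nonneg]
  rcases hΔ.le_or_le x (g • q) (g • x) (g ^ 2 • x) with h | h <;>
    linarith [hΔ.nonneg, dist_comm (g • x) q, dist_comm (g • q) (g • x)]

namespace FourPoint

variable {Δ c : ℝ} {g : Γ} {x : S}

theorem dist_pow_smul_add_dist_smul_le (hΔ : FourPoint Δ S)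
    (h2 : 2 * dist x (g • x) ≤ dist x (g ^ 2 • x) + c) (hL : c + Δ < dist x (g • x)) (n : ℕ) :
    dist x (g ^ n • x) + dist x (g • x) ≤ dist x (g ^ (n + 1) • x) + (c + Δ) := by
  have : Nonempty S := ⟨x⟩
  induction n with
  | zero =>
    have hsub := subadditive_dist_pow_smul g x 1 1
    norm_num at hsub ⊢
    linarith [hΔ.nonneg]
  | succ n ih =>
    have hfour := hΔ.le_or_le x (g ^ (n + 1) • x) (g ^ n • x) (g ^ (n + 2) • x)
    rw [dist_pow_smul_pow_smul g x n 2, dist_pow_smul_pow_smul g x (n + 1) 1,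
      dist_comm (g ^ (n + 1) • x), dist_pow_smul_pow_smul g x n 1, pow_one] at hfour
    rcases hfour with h | h <;> linarith

theorem dist_pow_smul_add_le (hΔ : FourPoint Δ S)
    (h2 : 2 * dist x (g • x) ≤ dist x (g ^ 2 • x) + c) (hL : 2 * c + 3 * Δ < 2 * dist x (g • x))
    (m n : ℕ) :
    dist x (g ^ m • x) + dist x (g ^ n • x) ≤ dist x (g ^ (m + n) • x) + (c + 2 * Δ) := by
  have : Nonempty S := ⟨x⟩
  have hstep := hΔ.dist_pow_smul_add_dist_smul_le h2 (by linarith [hΔ.nonneg])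
  cases n with
  | zero =>
    have h0 := hstep 0
    simp only [pow_zero, one_smul, dist_self, zero_add, pow_one, add_zero] at h0 ⊢
    linarith [hΔ.nonneg]
  | succ n =>
    have hfour := hΔ.le_or_le x (g ^ (m + 1) • x) (g ^ m • x) (g ^ (m + (n + 1)) • x)
    have hshift : dist (g ^ (m + 1) • x) (g ^ (m + (n + 1)) • x) = dist x (g ^ n • x) := by
      rw [show m + (n + 1) = (m + 1) + n by ring, dist_pow_smul_pow_smul]
    rw [dist_pow_smul_pow_smul g x m (n + 1), hshift, dist_comm (g ^ (m + 1) • x),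
      dist_pow_smul_pow_smul g x m 1, pow_one] at hfour
    rcases hfour with h | h <;> linarith [hstep m, hstep n]

end FourPoint

theorem dist_smul_le_translationLength_add [Nonempty S] {g : Γ} {x : S} {c : ℝ}
    (h : ∀ m n : ℕ,
      dist x (g ^ m • x) + dist x (g ^ n • x) ≤ dist x (g ^ (m + n) • x) + c) (n : ℕ) :
    dist x (g ^ n • x) ≤ n * translationLength S g + c := by
  rw [← sub_le_iff_le_add, ← translationLength_pow]
  refine le_translationLength (x := x) fun j => ?_
  rw [← pow_mul]
  induction j with
  | zero => simp
  | succ j ih =>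
    rw [mul_add, mul_one]
    push_cast
    linarith [h (n * j) n]

theorem AlmostMinimal.dist_pow_smul_le [Nonempty S] {δ Δ : ℝ} (hgeo : GeodesicSpace S)
    (hΔ : FourPoint Δ S) {g : Γ} {x : S} (h : AlmostMinimal δ g x)
    (hL : 2 * δ + 7 * Δ < 2 * dist x (g • x)) (n : ℕ) :
    dist x (g ^ n • x) ≤ n * translationLength S g + (δ + 4 * Δ) := by
  have hadd := hΔ.dist_pow_smul_add_le
    (h.two_mul_dist_le hgeo hΔ (by linarith [hΔ.nonneg])) (by linarith)
  refine (dist_smul_le_translationLength_add hadd n).trans_eq (by ring)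

end TranslationLength

theorem exists_displacementConstants {δ : ℝ} (hδ : 0 < δ) :
    ∃ T K : ℝ, DisplacementConstants.{u, v} δ T K := by
  refine ⟨18 * δ, 17 * δ, by positivity, by positivity, fun Γ _ S _ _ _ _ hS g hg x hx i =>
    ⟨mul_translationLength_le g x i, ?_⟩⟩
  have hx1 : 18 * δ ≤ dist x (g • x) := by
    simpa using hg.trans (by simpa using mul_translationLength_le g x 1)
  exact (hx.dist_pow_smul_le hS.geodesic (hS.fourPoint hδ.le) (by linarith) i).trans_eq (by ring)

section IsAxisPoint

variable {Γ : Type*} [Group Γ] {S : Type*} [MetricSpace S] [Nonempty S] [MulAction Γ S]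

/-- The orbit of `x` under the loxodromic element `G` is a quasigeodesic with multiplicative
constant one and additive constant `K`, so that `x` lies near the axis of `G`. -/
structure IsAxisPoint (K : ℝ) (G : Γ) (x : S) : Prop where
  isLoxodromic : IsLoxodromic S G
  dist_pow_smul_le (n : ℕ) : dist x (G ^ n • x) ≤ n * translationLength S G + K

theorem IsAxisPoint.nonneg {K : ℝ} {G : Γ} {x : S} (h : IsAxisPoint K G x) : 0 ≤ K := by
  simpa using h.dist_pow_smul_le 0

end IsAxisPoint

section Axis

variable {Γ : Type*} [Group Γ] {S : Type*} [MetricSpace S] [MulAction Γ S] [IsIsometricSMul Γ S]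

theorem dist_inv_smul_self (g : Γ) (x : S) : dist (g⁻¹ • x) x = dist x (g • x) := by
  rw [← dist_smul g, smul_inv_smul]

theorem dist_smul_smul_of_commute {g h : Γ} (hgh : Commute h g) (x : S) :
    dist (g • x) (h • g • x) = dist x (h • x) := by
  rw [smul_smul, hgh.eq, mul_smul, dist_smul]

theorem dist_pow_smul_le_mul (h : Γ) (x : S) (j : ℕ) :
    dist x (h ^ j • x) ≤ j * dist x (h • x) := by
  induction j with
  | zero => simp
  | succ j ih =>
    have hsub := subadditive_dist_pow_smul h x j 1
    simp only [pow_one] at hsub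
    push_cast
    linarith

theorem FourPoint.mul_le_dist_pow_smul {Δ C : ℝ} (hΔ : FourPoint Δ S) {h : Γ} {x o : S} {n : ℕ}
    (ho : ∀ j : ℕ, dist o (h ^ j • o) = dist x (h ^ j • x)) (hx : AlmostBetween C o x (h • x))
    (hfar : 2 * n * dist x (h • x) + (C + Δ) < 2 * dist o x) :
    n * (dist x (h • x) - (C + Δ)) ≤ dist x (h ^ n • x) := by
  have hstep : ∀ j ≤ n, dist o (h ^ j • x) + (dist x (h • x) - (C + Δ))
      ≤ dist o (h ^ (j + 1) • x) := by
    intro j hj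
    have htrans : AlmostBetween C (h ^ j • o) (h ^ j • x) (h ^ (j + 1) • x) := by
      simpa only [AlmostBetween, pow_succ, mul_smul, dist_smul] using hx
    have hjn : (j : ℝ) * dist x (h • x) ≤ n * dist x (h • x) := by gcongr
    have hbetween := hΔ.almostBetween_of_lt (o := o) htrans (by
      rw [ho, dist_smul]
      linarith [dist_triangle o (h ^ j • x) x, dist_comm (h ^ j • x) x,
        dist_pow_smul_le_mul h x j])
    linarith [dist_pow_smul_pow_smul h x j 1, congrArg (fun g : Γ => dist x (g • x)) (pow_one h)]
  have hdist : ∀ j ≤ n, dist o x + j * (dist x (h • x) - (C + Δ)) ≤ dist o (h ^ j • x) := by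
    intro j
    induction j with
    | zero => simp
    | succ j ih =>
      intro hj
      push_cast
      linarith [ih (by omega), hstep j (by omega)]
  linarith [hdist n le_rfl, dist_triangle o x (h ^ n • x)]

variable [Nonempty S]

theorem IsLoxodromic.not_isOfFinOrder {g : Γ} (hg : IsLoxodromic S g) : ¬ IsOfFinOrder g := by
  rw [isOfFinOrder_iff_pow_eq_one]
  rintro ⟨n, hn, h⟩
  have hle := mul_translationLength_le g (Classical.arbitrary S) n
  rw [h, one_smul, dist_self] at hle
  exact hle.not_gt (mul_pos (Nat.cast_pos.2 hn) hg)

namespace IsAxisPoint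

variable {K Δ : ℝ} {G : Γ} {x : S}

theorem exists_le_dist (h : IsAxisPoint K G x) (C : ℝ) : ∃ k : ℕ, C ≤ dist x (G ^ k • x) := by
  obtain ⟨k, hk⟩ := exists_nat_ge (C / translationLength S G)
  rw [div_le_iff₀ h.isLoxodromic] at hk
  exact ⟨k, hk.trans (mul_translationLength_le G x k)⟩

theorem almostBetween (h : IsAxisPoint K G x) (k : ℕ) :
    AlmostBetween (2 * K) ((G ^ k)⁻¹ • x) x (G ^ k • x) := by
  have hshift : dist ((G ^ k)⁻¹ • x) (G ^ k • x) = dist x (G ^ (k + k) • x) := by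
    rw [← dist_smul (G ^ k), smul_inv_smul, smul_smul, pow_add]
  have hlower := mul_translationLength_le G x (k + k)
  have hupper := h.dist_pow_smul_le k
  rw [AlmostBetween, dist_inv_smul_self, hshift]
  push_cast at hlower
  linarith

theorem dist_smul_le_of_commute (h : IsAxisPoint K G x) (hΔ : FourPoint Δ S) {f : Γ}
    (hf : Commute f G) : dist x (f • x) ≤ translationLength S f + (2 * K + 2 * Δ) := by
  rw [← sub_le_iff_le_add]
  refine le_translationLength (x := x) fun n => ?_
  obtain ⟨k, hk⟩ := h.exists_le_dist (n * dist x (f • x) + (K + Δ) + 1)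
  have hfk (j : ℕ) : Commute (f ^ j) (G ^ k) := hf.pow_pow j k
  -- Seen from a point far away on the axis, `f` acts almost like a translation.
  suffices ∃ o : S, AlmostBetween (2 * K + Δ) o x (f • x) ∧ dist o x = dist x (G ^ k • x) ∧
      ∀ j : ℕ, dist o (f ^ j • o) = dist x (f ^ j • x) by
    obtain ⟨o, hbetween, hox, ho⟩ := this
    refine Eq.trans_le (by ring)
      (hΔ.mul_le_dist_pow_smul ho hbetween (n := n) (by linarith [hΔ.nonneg]))
  rcases hΔ.almostBetween_or (h.almostBetween k) (f • x) with hbetween | hbetween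
  · exact ⟨_, hbetween, dist_inv_smul_self _ _,
      fun j => dist_smul_smul_of_commute (hfk j).inv_right x⟩
  · exact ⟨_, hbetween.symm, dist_comm _ _, fun j => dist_smul_smul_of_commute (hfk j) x⟩

theorem of_pow {g : Γ} {m : ℕ} (h : IsAxisPoint K (g ^ m) x) (hΔ : FourPoint Δ S) :
    IsAxisPoint (2 * K + 2 * Δ) g x where
  isLoxodromic := by
    have hpos := h.isLoxodromic
    rw [IsLoxodromic, translationLength_pow] at hpos
    exact pos_of_mul_pos_right hpos m.cast_nonneg
  dist_pow_smul_le n := by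
    rw [← translationLength_pow]
    exact h.dist_smul_le_of_commute hΔ ((Commute.refl g).pow_pow n m)

theorem almostBetween_smul_of_commute (h : IsAxisPoint K G x) (hΔ : FourPoint Δ S) {f : Γ}
    (hf : Commute f G) {k : ℕ} (hk : K + Δ + dist x (f • x) < dist x (G ^ k • x)) :
    AlmostBetween (2 * K + 2 * Δ) ((G ^ k)⁻¹ • x) (f • x) (G ^ k • x) := by
  have hfk : Commute f (G ^ k) := hf.pow_right k
  have hleft := dist_inv_smul_self (G ^ k) x
  have hright := dist_comm x (G ^ k • x)
  set o := (G ^ k)⁻¹ • x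
  set o' := G ^ k • x
  have ho : dist o (f • o) = dist x (f • x) := dist_smul_smul_of_commute hfk.inv_right x
  have ho' : dist o' (f • o') = dist x (f • x) := dist_smul_smul_of_commute hfk x
  have htrans : AlmostBetween (2 * K) (f • o) (f • x) (f • o') := by
    simpa only [AlmostBetween, dist_smul] using h.almostBetween k
  have hreplace : AlmostBetween (2 * K + Δ) o (f • x) (f • o') :=
    hΔ.almostBetween_of_lt htrans (by
      rw [dist_smul]
      linarith [dist_triangle o (f • x) x, dist_comm (f • x) x, hΔ.nonneg])
  have hreplace' : AlmostBetween (2 * K + Δ + Δ) o' (f • x) o :=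
    hΔ.almostBetween_of_lt hreplace.symm (by
      rw [dist_smul]
      linarith [dist_triangle o' (f • x) x, dist_comm (f • x) x])
  exact hreplace'.symm.mono (by linarith)

theorem dist_smul_le_of_inverts (h : IsAxisPoint K G x) (hΔ : FourPoint Δ S) {t f : Γ}
    (ht : SemiconjBy t G G⁻¹) (htf : Commute t f) (hf : Commute f G) :
    dist x (f • x) ≤ dist x (t • x) + 3 * K + 2 * Δ := by
  obtain ⟨k, hk⟩ := h.exists_le_dist (K + Δ + dist x (f • x) + 1)
  have hbetween := h.almostBetween_smul_of_commute hΔ hf (k := k) (by linarith)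
  have hswap : t • (G ^ k)⁻¹ • x = G ^ k • t • x := by
    have htk := ht.inv_right.pow_right k
    rw [inv_inv, inv_pow] at htk
    rw [smul_smul, htk.eq, mul_smul]
  have hdist : dist ((G ^ k)⁻¹ • x) (f • x) = dist (G ^ k • t • x) (f • t • x) := by
    rw [← dist_smul t, hswap, smul_smul t f, htf.eq, mul_smul]
  have hG : dist (G ^ k • x) (G ^ k • t • x) = dist x (t • x) := dist_smul _ _ _
  have hft : dist (f • x) (f • t • x) = dist x (t • x) := dist_smul _ _ _
  have hupper := dist_triangle4 (G ^ k • x) (G ^ k • t • x) (f • t • x) (f • x)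
  have hlower := dist_triangle4 (G ^ k • t • x) (G ^ k • x) (f • x) (f • t • x)
  rw [dist_comm (f • t • x) (f • x)] at hupper
  rw [dist_comm (G ^ k • t • x) (G ^ k • x)] at hlower
  have hdiam := dist_triangle ((G ^ k)⁻¹ • x) x (G ^ k • x)
  have hx := dist_inv_smul_self (G ^ k) x
  rcases hΔ.almostBetween_or (h.almostBetween k) (f • x) with hnear | hnear <;>
    linarith [dist_comm (f • x) (G ^ k • x), dist_comm (f • x) x]

end IsAxisPoint

end Axis

namespace AcylindricalWith

variable {Γ : Type*} [Group Γ] {S : Type*} [MetricSpace S] [MulAction Γ S]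
  {R : ℝ → ℝ} {N : ℝ → ℕ}

theorem not_injOn (h : AcylindricalWith Γ S R N) {r : ℝ} (hr : 0 < r) {x x' : S}
    (hR : R r ≤ dist x x') {f : ℕ → Γ} (hx : ∀ i ≤ N r, dist x (f i • x) ≤ r)
    (hx' : ∀ i ≤ N r, dist x' (f i • x') ≤ r) : ¬ InjOn f (Iic (N r)) := by
  intro hinj
  have hsub : f '' Iic (N r) ⊆ {g : Γ | dist x (g • x) ≤ r ∧ dist x' (g • x') ≤ r} :=
    image_subset_iff.2 fun i hi => ⟨hx i hi, hx' i hi⟩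
  have hcard := (encard_le_encard hsub).trans (h r hr x x' hR)
  rw [hinj.encard_image, ← Finset.coe_Iic, encard_coe_eq_coe_finsetCard, Nat.card_Iic] at hcard
  exact absurd (Nat.cast_le.1 hcard) (by omega)

variable [IsIsometricSMul Γ S] [Nonempty S] {K : ℝ} {G : Γ} {x : S}

theorem isOfFinOrder_of_commute (h : AcylindricalWith Γ S R N) (hx : IsAxisPoint K G x) {f : Γ}
    (hf : Commute f G) {r : ℝ} (hr : 0 < r) (hd : ∀ i ≤ N r, dist x (f ^ i • x) ≤ r) :
    IsOfFinOrder f := by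
  by_contra hfin
  obtain ⟨k, hk⟩ := hx.exists_le_dist (R r)
  refine h.not_injOn hr hk hd (fun i hi => ?_) (injective_pow_iff_not_isOfFinOrder.2 hfin).injOn
  rw [dist_smul_smul_of_commute (hf.pow_pow i k)]
  exact hd i hi

theorem one_le_mul_translationLength (h : AcylindricalWith Γ S R N) (hx : IsAxisPoint K G x) :
    1 ≤ N (K + 1) * translationLength S G := by
  by_contra! hlt
  refine hx.isLoxodromic.not_isOfFinOrder
    (h.isOfFinOrder_of_commute hx (.refl G) (r := K + 1) (by linarith [hx.nonneg]) fun i hi => ?_)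
  have hi' : (i : ℝ) * translationLength S G ≤ N (K + 1) * translationLength S G :=
    mul_le_mul_of_nonneg_right (by exact_mod_cast hi) hx.isLoxodromic.le
  linarith [hx.dist_pow_smul_le i]

theorem isOfFinOrder_of_inverts (h : AcylindricalWith Γ S R N) {Δ : ℝ} (hΔ : FourPoint Δ S)
    (hx : IsAxisPoint K G x) {t : Γ} (ht : SemiconjBy t G G⁻¹) : IsOfFinOrder t := by
  have hsq : Commute (t ^ 2) G := by
    have hinv := ht.inv_right
    rw [inv_inv] at hinv
    rw [pow_two]
    exact hinv.mul_left ht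
  have hr : 0 < dist x (t • x) + 3 * K + 2 * Δ + 1 := by
    have := hx.nonneg
    have := hΔ.nonneg
    positivity
  have hfin : IsOfFinOrder (t ^ 2) := h.isOfFinOrder_of_commute hx hsq hr fun i _ =>
    (hx.dist_smul_le_of_inverts hΔ ht (((Commute.refl t).pow_right 2).pow_right i)
      (hsq.pow_left i)).trans (by linarith)
  exact hfin.of_pow two_ne_zero

end AcylindricalWith

section Morse

variable {S : Type*} [MetricSpace S]

/-- The path `α`, parametrized by arc length, is a quasigeodesic with multiplicative constant
`lam` and additive constant `k`. -/
def ArcPath.IsQuasigeodesic (lam k : ℝ) (α : ArcPath S) : Prop :=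
  ∀ s ∈ Icc 0 α.len, ∀ t ∈ Icc 0 α.len, |s - t| ≤ lam * dist (α.toFun s) (α.toFun t) + k

theorem FourPoint.exists_dist_le_of_abs_sub_le_two_pow {Δ : ℝ} (hΔ : FourPoint Δ S)
    (α : ArcPath S) (x : S) (N : ℕ) {C s t : ℝ} (hs : s ∈ Icc 0 α.len) (ht : t ∈ Icc 0 α.len)
    (hst : |s - t| ≤ 2 ^ N) (hx : AlmostBetween C (α.toFun s) x (α.toFun t)) :
    ∃ u ∈ Icc 0 α.len, 2 * dist x (α.toFun u) ≤ C + N * Δ + 2 := by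
  induction N generalizing C s t with
  | zero =>
    refine ⟨s, hs, ?_⟩
    have htri := dist_triangle x (α.toFun t) (α.toFun s)
    simp only [pow_zero] at hst
    push_cast
    linarith [α.dist_le hs ht, dist_comm x (α.toFun s), dist_comm (α.toFun t) (α.toFun s)]
  | succ N ih =>
    have hm : (s + t) / 2 ∈ Icc 0 α.len := by
      constructor <;> linarith [hs.1, hs.2, ht.1, ht.2]
    rw [pow_succ, abs_le] at hst
    push_cast
    rw [show C + (N + 1) * Δ + 2 = C + Δ + N * Δ + 2 by ring]
    rcases hΔ.almostBetween_or hx (α.toFun ((s + t) / 2)) with h | h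
    · exact ih hs hm (abs_le.2 ⟨by linarith, by linarith⟩) h
    · exact ih hm ht (abs_le.2 ⟨by linarith, by linarith⟩) h

/-- The radius in the Morse lemma for quasigeodesics with constants `lam` and `k` in a space
satisfying the four-point condition with constant `Δ`: the largest `D` compatible with the
logarithmic distance estimate for paths of length `6 * lam * D + k`. -/
def stabilityRadius (Δ lam k : ℝ) : ℝ :=
  sSup {D : ℝ | ∀ N : ℕ, 6 * lam * D + k ≤ 2 ^ N → 2 * D ≤ (N + 2) * Δ + 2}

theorem eventually_mul_add_le_two_pow (a b : ℝ) : ∀ᶠ n : ℕ in atTop, a * n + b ≤ 2 ^ n := by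
  have hlin : Tendsto (fun n : ℕ => (n : ℝ) ^ 1 / 2 ^ n) atTop (𝓝 0) :=
    tendsto_pow_const_div_const_pow_of_one_lt 1 one_lt_two
  have hconst : Tendsto (fun n : ℕ => (n : ℝ) ^ 0 / 2 ^ n) atTop (𝓝 0) :=
    tendsto_pow_const_div_const_pow_of_one_lt 0 one_lt_two
  have hsum := (hlin.const_mul a).add (hconst.const_mul b)
  simp only [mul_zero, add_zero] at hsum
  filter_upwards [hsum.eventually_lt_const one_pos] with n hn
  rw [pow_one, pow_zero, mul_div_assoc', mul_div_assoc', ← add_div, mul_one,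
    div_lt_one (by positivity)] at hn
  exact hn.le

section StabilityRadius

variable {Δ lam : ℝ} (hΔ : 0 ≤ Δ) (hlam : 0 ≤ lam) (k : ℝ)
include hΔ hlam

theorem bddAbove_stabilityRadius :
    BddAbove {D : ℝ | ∀ N : ℕ, 6 * lam * D + k ≤ 2 ^ N → 2 * D ≤ (N + 2) * Δ + 2} := by
  have hΔ1 : 0 < Δ + 1 := by linarith
  obtain ⟨n₀, hn₀⟩ := eventually_atTop.1 (eventually_mul_add_le_two_pow
    (6 * lam * (Δ + 1)) (6 * lam * (Δ + 1) + k))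
  refine ⟨max (2 * Δ + 2) (n₀ * (Δ + 1)), fun D hD => ?_⟩
  by_contra! hlt
  obtain ⟨hlarge, hn₀D⟩ := max_lt_iff.1 hlt
  have hfloor := Nat.floor_le (show 0 ≤ D / (Δ + 1) by apply div_nonneg <;> linarith)
  have hfloor' := Nat.lt_floor_add_one (D / (Δ + 1))
  have hn := hn₀ ⌊D / (Δ + 1)⌋₊ (Nat.le_floor (by rw [le_div_iff₀ hΔ1]; exact hn₀D.le))
  rw [le_div_iff₀ hΔ1] at hfloor
  rw [div_lt_iff₀ hΔ1] at hfloor'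
  have hDN : 6 * lam * D ≤ 6 * lam * ((⌊D / (Δ + 1)⌋₊ + 1) * (Δ + 1)) := by gcongr
  have := hD ⌊D / (Δ + 1)⌋₊ (by linarith)
  have : (0 : ℝ) ≤ (⌊D / (Δ + 1)⌋₊ : ℝ) := Nat.cast_nonneg _
  linarith

theorem stabilityRadius_nonneg : 0 ≤ stabilityRadius Δ lam k :=
  le_csSup (bddAbove_stabilityRadius hΔ hlam k) fun N _ => by rw [mul_zero]; positivity

end StabilityRadius

section Stability

variable {Δ lam k D : ℝ} {p α : ArcPath S}

theorem FourPoint.almostBetween_of_near (hΔ : FourPoint Δ S) {C : ℝ} {q x y z : S}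
    (hx : AlmostBetween C y x z) (hnear : dist q y ≤ D) (hfar : D ≤ dist q x)
    (hy : q = y ∨ 2 * D ≤ dist y x) (hCD : C + Δ < 2 * D) : AlmostBetween (C + Δ) q x z := by
  have : Nonempty S := ⟨x⟩
  rcases hy with rfl | hy
  · exact hx.mono (by linarith [hΔ.nonneg])
  · exact hΔ.almostBetween_of_lt hx (by linarith)

theorem ArcPath.exists_near (hD : 0 ≤ D)
    (hnear : ∀ t ∈ Icc 0 p.len, ∃ s ∈ Icc 0 α.len, dist (α.toFun s) (p.toFun t) ≤ D)
    {e r s₀ : ℝ} (he : e ∈ Icc 0 p.len) (hr : r ∈ Icc 0 p.len) (hs₀ : s₀ ∈ Icc 0 α.len)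
    (h : α.toFun s₀ = p.toFun e) :
    ∃ u ∈ uIcc e r, |u - r| ≤ 2 * D ∧ ∃ s ∈ Icc 0 α.len,
      dist (α.toFun s) (p.toFun u) ≤ D ∧ (α.toFun s = p.toFun u ∨ 2 * D ≤ |u - r|) := by
  rcases le_total |e - r| (2 * D) with her | her
  · exact ⟨e, left_mem_uIcc, her, s₀, hs₀, by rwa [h, dist_self], .inl h⟩
  obtain ⟨u, hu, hur⟩ : ∃ u ∈ uIcc e r, |u - r| = 2 * D := by
    have hcont : ContinuousOn (fun u => |u - r|) (uIcc e r) := by fun_prop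
    exact intermediate_value_uIcc hcont (mem_uIcc.2 (.inr ⟨by simpa using hD, her⟩))
  obtain ⟨s, hs, hsu⟩ := hnear u (uIcc_subset_Icc he hr hu)
  exact ⟨u, hu, hur.le, s, hs, hsu, .inr hur.ge⟩

theorem FourPoint.two_mul_le_of_near_of_far (hΔ : FourPoint Δ S) (hlam : 0 ≤ lam)
    (hα : α.IsQuasigeodesic lam k) (hp : p.IsGeodesic)
    (hj : p.Joins (α.toFun 0) (α.toFun α.len)) (hD : 0 ≤ D)
    (hnear : ∀ t ∈ Icc 0 p.len, ∃ s ∈ Icc 0 α.len, dist (α.toFun s) (p.toFun t) ≤ D)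
    {r : ℝ} (hr : r ∈ Icc 0 p.len) (hfar : ∀ s ∈ Icc 0 α.len, D ≤ dist (α.toFun s) (p.toFun r))
    {N : ℕ} (hN : 6 * lam * D + k ≤ 2 ^ N) : 2 * D ≤ (N + 2) * Δ + 2 := by
  have : Nonempty S := ⟨p.toFun 0⟩
  rcases le_or_gt D Δ with hDΔ | hDΔ
  · nlinarith [hΔ.nonneg, N.cast_nonneg (α := ℝ)]
  obtain ⟨u, hu, hur, s, hs, hsu, hs'⟩ :=
    ArcPath.exists_near hD hnear p.zero_mem hr α.zero_mem hj.1.symm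
  obtain ⟨v, hv, hvr, t, ht, htv, ht'⟩ :=
    ArcPath.exists_near hD hnear p.len_mem hr α.len_mem hj.2.symm
  rw [uIcc_of_le hr.1] at hu
  rw [uIcc_of_ge hr.2] at hv
  have hup : u ∈ Icc 0 p.len := ⟨hu.1, hu.2.trans hr.2⟩
  have hvp : v ∈ Icc 0 p.len := ⟨hr.1.trans hv.1, hv.2⟩
  rw [← hp u hup r hr] at hur hs'
  rw [← hp v hvp r hr] at hvr ht'
  have hbetween : AlmostBetween 0 (p.toFun u) (p.toFun r) (p.toFun v) := by
    rw [AlmostBetween, hp u hup r hr, hp r hr v hvp, hp u hup v hvp, abs_sub_comm u r,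
      abs_sub_comm r v, abs_sub_comm u v, abs_of_nonneg (sub_nonneg.2 hu.2),
      abs_of_nonneg (sub_nonneg.2 hv.1), abs_of_nonneg (sub_nonneg.2 (hu.2.trans hv.1))]
    linarith
  have hbetween' := hΔ.almostBetween_of_near
    (hΔ.almostBetween_of_near hbetween hsu (hfar s hs) hs' (by linarith [hΔ.nonneg])).symm
    htv (hfar t ht) ht' (by linarith [hΔ.nonneg])
  have hdist : dist (α.toFun t) (α.toFun s) ≤ 6 * D := by
    linarith [dist_triangle4 (α.toFun t) (p.toFun v) (p.toFun u) (α.toFun s),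
      dist_triangle (p.toFun v) (p.toFun r) (p.toFun u), dist_comm (p.toFun u) (α.toFun s),
      dist_comm (p.toFun r) (p.toFun u)]
  have hts : |t - s| ≤ 2 ^ N := by
    linarith [hα t ht s hs, mul_le_mul_of_nonneg_left hdist hlam]
  obtain ⟨q, hq, hle⟩ := hΔ.exists_dist_le_of_abs_sub_le_two_pow α _ N ht hs hts hbetween'
  linarith [hfar q hq, dist_comm (α.toFun q) (p.toFun r)]

namespace ArcPath.IsQuasigeodesic

theorem exists_dist_le_stabilityRadius (hα : α.IsQuasigeodesic lam k) (hΔ : FourPoint Δ S)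
    (hlam : 0 ≤ lam) (hp : p.IsGeodesic) (hj : p.Joins (α.toFun 0) (α.toFun α.len)) {t : ℝ}
    (ht : t ∈ Icc 0 p.len) :
    ∃ s ∈ Icc 0 α.len, dist (α.toFun s) (p.toFun t) ≤ stabilityRadius Δ lam k := by
  have : Nonempty S := ⟨p.toFun 0⟩
  have hcompact : IsCompact α.image := isCompact_Icc.image_of_continuousOn α.continuousOn
  have hcont : ContinuousOn (fun t => Metric.infDist (p.toFun t) α.image) (Icc 0 p.len) :=
    (Metric.continuous_infDist_pt _).comp_continuousOn p.continuousOn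
  obtain ⟨r, hr, hmax⟩ := isCompact_Icc.exists_isMaxOn ⟨0, p.zero_mem⟩ hcont
  have hnear : ∀ t ∈ Icc 0 p.len, ∃ s ∈ Icc 0 α.len,
      dist (α.toFun s) (p.toFun t) ≤ Metric.infDist (p.toFun r) α.image := by
    intro t ht
    obtain ⟨_, ⟨s, hs, rfl⟩, h⟩ :=
      hcompact.exists_infDist_eq_dist ⟨_, 0, α.zero_mem, rfl⟩ (p.toFun t)
    exact ⟨s, hs, by rw [dist_comm, ← h]; exact hmax ht⟩
  obtain ⟨s, hs, hst⟩ := hnear t ht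
  refine ⟨s, hs, hst.trans (le_csSup (bddAbove_stabilityRadius hΔ.nonneg hlam k) fun N => ?_)⟩
  refine hΔ.two_mul_le_of_near_of_far hlam hα hp hj Metric.infDist_nonneg hnear hr fun s hs => ?_
  rw [dist_comm]
  exact Metric.infDist_le_dist_of_mem ⟨s, hs, rfl⟩

theorem exists_dist_le_of_almostBetween (hα : α.IsQuasigeodesic lam k) (hgeo : GeodesicSpace S)
    (hΔ : FourPoint Δ S) (hlam : 0 ≤ lam) {x q y : S} (hj : α.Joins x y) {C : ℝ} (hC : 0 ≤ C)
    (hq : AlmostBetween C x q y) :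
    ∃ s ∈ Icc 0 α.len, dist q (α.toFun s) ≤ C + Δ + stabilityRadius Δ lam k := by
  obtain ⟨p, hp, hpj⟩ := hgeo x y
  obtain ⟨t, ht, hqt⟩ := hΔ.exists_dist_le_of_almostBetween hp hpj hC hq
  obtain ⟨s, hs, hst⟩ := hα.exists_dist_le_stabilityRadius hΔ hlam hp (by rwa [hj.1, hj.2]) ht
  refine ⟨s, hs, ?_⟩
  linarith [dist_triangle q (p.toFun t) (α.toFun s), dist_comm (p.toFun t) (α.toFun s)]

theorem exists_dist_le_both_halves (hα : α.IsQuasigeodesic lam k) (hΔ : FourPoint Δ S)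
    (hlam : 0 ≤ lam) (hp : p.IsGeodesic) (hj : p.Joins (α.toFun 0) (α.toFun α.len)) {s : ℝ}
    (hs : s ∈ Icc 0 α.len) :
    ∃ t ∈ Icc 0 p.len,
      (∃ u ∈ Icc 0 s, dist (p.toFun t) (α.toFun u) ≤ stabilityRadius Δ lam k) ∧
        ∃ v ∈ Icc s α.len, dist (p.toFun t) (α.toFun v) ≤ stabilityRadius Δ lam k := by
  have : Nonempty S := ⟨α.toFun 0⟩
  have hR := stabilityRadius_nonneg hΔ.nonneg hlam k
  set R := stabilityRadius Δ lam k
  have hcover : p.image ⊆ Metric.cthickening R (α.toFun '' Icc 0 s) ∪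
      Metric.cthickening R (α.toFun '' Icc s α.len) := by
    rintro _ ⟨t, ht, rfl⟩
    obtain ⟨u, hu, htu⟩ := hα.exists_dist_le_stabilityRadius hΔ hlam hp hj ht
    rw [dist_comm] at htu
    rcases le_total u s with hus | hus
    · exact .inl (Metric.mem_cthickening_of_dist_le _ _ _ _ (mem_image_of_mem _ ⟨hu.1, hus⟩) htu)
    · exact .inr (Metric.mem_cthickening_of_dist_le _ _ _ _ (mem_image_of_mem _ ⟨hus, hu.2⟩) htu)
  obtain ⟨t, ht, hleft, hright⟩ := p.exists_mem_inter Metric.isClosed_cthickening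
    Metric.isClosed_cthickening hcover
    (Metric.self_subset_cthickening _ ⟨0, ⟨le_rfl, hs.1⟩, hj.1.symm⟩)
    (Metric.self_subset_cthickening _ ⟨α.len, ⟨hs.2, le_rfl⟩, hj.2.symm⟩)
  exact ⟨t, ht, (α.mem_cthickening_image_Icc le_rfl hs.2 hR).1 hleft,
    (α.mem_cthickening_image_Icc hs.1 le_rfl hR).1 hright⟩

theorem almostBetween (hα : α.IsQuasigeodesic lam k) (hgeo : GeodesicSpace S)
    (hΔ : FourPoint Δ S) (hlam : 0 ≤ lam) {s : ℝ} (hs : s ∈ Icc 0 α.len) :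
    AlmostBetween (2 * ((1 + 2 * lam) * stabilityRadius Δ lam k + k))
      (α.toFun 0) (α.toFun s) (α.toFun α.len) := by
  obtain ⟨p, hp, hj⟩ := hgeo (α.toFun 0) (α.toFun α.len)
  obtain ⟨t, ht, ⟨u, hu, htu⟩, v, hv, htv⟩ := hα.exists_dist_le_both_halves hΔ hlam hp hj hs
  set R := stabilityRadius Δ lam k
  have hu' : u ∈ Icc 0 α.len := ⟨hu.1, hu.2.trans hs.2⟩
  have huv : v - u ≤ 2 * lam * R + k := by
    have hquasi := hα v ⟨hs.1.trans hv.1, hv.2⟩ u hu'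
    rw [abs_of_nonneg (by linarith [hu.2, hv.1])] at hquasi
    have hdist : dist (α.toFun v) (α.toFun u) ≤ 2 * R := by
      linarith [dist_triangle_left (α.toFun v) (α.toFun u) (p.toFun t)]
    linarith [mul_le_mul_of_nonneg_left hdist hlam]
  have hus : dist (α.toFun u) (α.toFun s) ≤ s - u := by
    simpa only [abs_sub_comm u, abs_of_nonneg (sub_nonneg.2 hu.2)] using α.dist_le hu' hs
  have hts : dist (p.toFun t) (α.toFun s) ≤ (1 + 2 * lam) * R + k := by
    linarith [dist_triangle (p.toFun t) (α.toFun u) (α.toFun s), hv.1]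
  linarith [hp.dist_left hj ht, hp.dist_right hj ht, hp.len_eq hj,
    dist_triangle (α.toFun 0) (p.toFun t) (α.toFun s), dist_comm (p.toFun t) (α.toFun s),
    dist_triangle (α.toFun s) (p.toFun t) (α.toFun α.len)]

end ArcPath.IsQuasigeodesic

end Stability

end Morse

section PathOperations

variable {S : Type*} [MetricSpace S]

theorem hasUnitSpeedOn_Icc_mono {f : ℝ → S} {a b a' b' : ℝ} (h : HasUnitSpeedOn f (Icc a b))
    (ha : a ≤ a') (hb : b' ≤ b) : HasUnitSpeedOn f (Icc a' b') := by
  intro x hx y hy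
  rw [← h ⟨ha.trans hx.1, hx.2.trans hb⟩ ⟨ha.trans hy.1, hy.2.trans hb⟩,
    inter_eq_right.2 (Icc_subset_Icc hx.1 hy.2),
    inter_eq_right.2 (Icc_subset_Icc (ha.trans hx.1) (hy.2.trans hb))]

theorem hasUnitSpeedOn_Icc_shift {f : ℝ → S} {a b : ℝ} (c : ℝ) (h : HasUnitSpeedOn f (Icc a b)) :
    HasUnitSpeedOn (fun u => f (c + u)) (Icc (a - c) (b - c)) := by
  intro x hx y hy
  have hcomp := eVariationOn.comp_eq_of_monotoneOn f (t := Icc (a - c) (b - c) ∩ Icc x y)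
    (fun u => c + u) (fun u _ v _ huv => by simpa using huv)
  rw [image_inter (add_right_injective c), image_const_add_Icc, image_const_add_Icc,
    add_sub_cancel, add_sub_cancel, h ⟨by linarith [hx.1], by linarith [hx.2]⟩
      ⟨by linarith [hy.1], by linarith [hy.2]⟩, add_sub_add_left_eq_sub] at hcomp
  exact hcomp

theorem hasUnitSpeedOn_congr {f f' : ℝ → S} {A : Set ℝ} (h : HasUnitSpeedOn f A)
    (he : EqOn f f' A) : HasUnitSpeedOn f' A := by
  intro x hx y hy
  rw [← h hx hy]
  exact eVariationOn.eq_of_eqOn fun u hu => (he hu.1).symm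

namespace ArcPath

/-- The restriction of a path to a subinterval, reparametrized to start at time `0`. -/
def sub (p : ArcPath S) (s t : ℝ) (hs : 0 ≤ s) (hst : s ≤ t) (ht : t ≤ p.len) : ArcPath S where
  len := t - s
  toFun := fun u => p.toFun (s + u)
  len_nonneg := by linarith
  unit_speed := by
    have := hasUnitSpeedOn_Icc_shift s (hasUnitSpeedOn_Icc_mono p.unit_speed hs ht)
    rwa [sub_self] at this

theorem sub_joins (p : ArcPath S) {s t : ℝ} (hs : 0 ≤ s) (hst : s ≤ t) (ht : t ≤ p.len) :
    (p.sub s t hs hst ht).Joins (p.toFun s) (p.toFun t) := by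
  constructor <;> simp [sub]

theorem IsQuasigeodesic.sub {lam k : ℝ} {p : ArcPath S} (h : p.IsQuasigeodesic lam k) {s t : ℝ}
    (hs : 0 ≤ s) (hst : s ≤ t) (ht : t ≤ p.len) : (p.sub s t hs hst ht).IsQuasigeodesic lam k := by
  rintro u ⟨hu₀, hu₁⟩ v ⟨hv₀, hv₁⟩
  simp only [ArcPath.sub] at hu₁ hv₁ ⊢
  simpa only [add_sub_add_left_eq_sub] using
    h (s + u) ⟨by linarith, by linarith⟩ (s + v) ⟨by linarith, by linarith⟩

/-- The concatenation of two paths. -/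
def trans (p q : ArcPath S) (h : p.toFun p.len = q.toFun 0) : ArcPath S where
  len := p.len + q.len
  toFun := fun u => if u ≤ p.len then p.toFun u else q.toFun (u - p.len)
  len_nonneg := add_nonneg p.len_nonneg q.len_nonneg
  unit_speed := by
    refine HasUnitSpeedOn.Icc_Icc (y := p.len) ?_ ?_
    · exact hasUnitSpeedOn_congr p.unit_speed fun u hu => by simp [hu.2]
    · have hshift := hasUnitSpeedOn_Icc_shift (-p.len) q.unit_speed
      rw [sub_neg_eq_add, sub_neg_eq_add, zero_add, add_comm q.len] at hshift
      refine hasUnitSpeedOn_congr hshift fun u hu => ?_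
      rcases hu.1.eq_or_lt with rfl | hlt
      · simp [h]
      · simp only [not_le.2 hlt, if_false, neg_add_eq_sub]

theorem trans_toFun_left {p q : ArcPath S} (h : p.toFun p.len = q.toFun 0) {u : ℝ}
    (hu : u ≤ p.len) : (p.trans q h).toFun u = p.toFun u := by
  simp [trans, hu]

theorem trans_toFun_right {p q : ArcPath S} (h : p.toFun p.len = q.toFun 0) {u : ℝ}
    (hu : 0 ≤ u) : (p.trans q h).toFun (p.len + u) = q.toFun u := by
  rcases hu.eq_or_lt with rfl | hlt
  · simp [trans, h]
  · simp [trans, hlt]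

theorem Joins.trans {p q : ArcPath S} {x y z : S} (hp : p.Joins x y) (hq : q.Joins y z) :
    (p.trans q (hp.2.trans hq.1.symm)).Joins x z :=
  ⟨by rw [trans_toFun_left _ p.len_nonneg, hp.1],
    by rw [show (p.trans q _).len = p.len + q.len from rfl, trans_toFun_right _ q.len_nonneg, hq.2]⟩

theorem reverse_reverse (p : ArcPath S) : p.reverse.reverse = p := by
  cases p
  simp [reverse]

section Smul

variable {Γ : Type*} [Group Γ] [MulAction Γ S] [IsIsometricSMul Γ S]

/-- The translate of a path by a group element acting isometrically. -/
def smul (g : Γ) (p : ArcPath S) : ArcPath S where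
  len := p.len
  toFun := fun u => g • p.toFun u
  len_nonneg := p.len_nonneg
  unit_speed := by
    intro x hx y hy
    rw [← p.unit_speed hx hy]
    simp only [eVariationOn, (isometry_smul S g).edist_eq]

theorem Joins.smul {p : ArcPath S} {x y : S} (h : p.Joins x y) (g : Γ) :
    (p.smul g).Joins (g • x) (g • y) :=
  ⟨by simp [ArcPath.smul, h.1], by simp [ArcPath.smul, h.2]⟩

end Smul

end ArcPath

end PathOperations

section CopyCount

variable {Γ : Type*} [Group Γ] {S : Type*} [MetricSpace S] [MulAction Γ S]

/-- A family of non-overlapping copies `g i • w` of `w` in `α`, starting at the times `s i`; it is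
the notion underlying `HasCopies`, with an arbitrary index type. -/
structure IsCopyFamily (w α : ArcPath S) {ι : Type*} (s : ι → ℝ) (g : ι → Γ) : Prop where
  nonneg (i : ι) : 0 ≤ s i
  add_len_le (i : ι) : s i + w.len ≤ α.len
  toFun_add (i : ι) : ∀ t ∈ Icc 0 w.len, α.toFun (s i + t) = g i • w.toFun t
  pairwise : Pairwise fun i j => w.len ≤ |s i - s j|

theorem hasCopies_iff {w α : ArcPath S} {n : ℕ} :
    HasCopies Γ w α n ↔ ∃ (s : Fin n → ℝ) (g : Fin n → Γ), IsCopyFamily w α s g :=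
  ⟨fun ⟨s, g, hs, hg, hp⟩ => ⟨s, g, fun i => (hs i).1, fun i => (hs i).2, hg, hp⟩,
    fun ⟨s, g, h⟩ => ⟨s, g, fun i => ⟨h.nonneg i, h.add_len_le i⟩, h.toFun_add, h.pairwise⟩⟩

namespace IsCopyFamily

variable {w α : ArcPath S} {ι : Type*} {s : ι → ℝ} {g : ι → Γ}

theorem comp_injective (h : IsCopyFamily w α s g) {κ : Type*} {e : κ → ι}
    (he : Function.Injective e) : IsCopyFamily w α (s ∘ e) (g ∘ e) :=
  ⟨fun _ => h.nonneg _, fun _ => h.add_len_le _, fun _ => h.toFun_add _,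
    fun _ _ hij => h.pairwise (he.ne hij)⟩

theorem hasCopies [Fintype ι] (h : IsCopyFamily w α s g) :
    HasCopies Γ w α (Fintype.card ι) :=
  hasCopies_iff.2 ⟨_, _, h.comp_injective (Fintype.equivFin ι).symm.injective⟩

theorem floor_injective (hw : 0 < w.len) (h : IsCopyFamily w α s g) :
    Function.Injective fun i => ⌊s i / w.len⌋₊ := by
  intro i j hij
  by_contra hne
  have hsep : w.len ≤ |s i - s j| := h.pairwise hne
  have hi := div_nonneg (h.nonneg i) hw.le
  have hj := div_nonneg (h.nonneg j) hw.le
  simp only at hij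
  have hlt : |s i / w.len - s j / w.len| < 1 := by
    have hij' : (⌊s i / w.len⌋₊ : ℝ) = ⌊s j / w.len⌋₊ := by rw [hij]
    rw [abs_lt]
    constructor <;> linarith [Nat.floor_le hi, Nat.lt_floor_add_one (s i / w.len),
      Nat.floor_le hj, Nat.lt_floor_add_one (s j / w.len)]
  rw [← sub_div, abs_div, abs_of_pos hw, div_lt_one hw] at hlt
  linarith

theorem card_mul_len_le [Fintype ι] (hw : 0 < w.len) (h : IsCopyFamily w α s g) :
    Fintype.card ι * w.len ≤ α.len := by
  have hmem : ∀ i ∈ (Finset.univ : Finset ι),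
      ⌊s i / w.len⌋₊ ∈ Finset.range ⌊α.len / w.len⌋₊ := by
    intro i _
    rw [Finset.mem_range, ← Nat.add_one_le_iff,
      ← Nat.floor_add_one (div_nonneg (h.nonneg i) hw.le), div_add_one hw.ne']
    exact Nat.floor_mono (div_le_div_of_nonneg_right (h.add_len_le i) hw.le)
  have hcard := Finset.card_le_card_of_injOn _ hmem (h.floor_injective hw).injOn
  rw [Finset.card_univ, Finset.card_range] at hcard
  rw [← le_div_iff₀ hw]
  exact (Nat.cast_le.2 hcard).trans (Nat.floor_le (div_nonneg α.len_nonneg hw.le))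

theorem trans {p q : ArcPath S} (hpq : p.toFun p.len = q.toFun 0) (hp : IsCopyFamily w p s g)
    {κ : Type*} {s' : κ → ℝ} {g' : κ → Γ} (hq : IsCopyFamily w q s' g') :
    IsCopyFamily w (p.trans q hpq) (Sum.elim s fun i => p.len + s' i) (Sum.elim g g') := by
  have hlen : (p.trans q hpq).len = p.len + q.len := rfl
  have hbefore (i : ι) (j : κ) : w.len ≤ p.len + s' j - s i := by
    linarith [hp.add_len_le i, hq.nonneg j]
  refine ⟨?_, ?_, ?_, ?_⟩
  · exact Sum.rec hp.nonneg fun i => add_nonneg p.len_nonneg (hq.nonneg i)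
  · rintro (i | i) <;> simp only [Sum.elim_inl, Sum.elim_inr, hlen]
    · linarith [hp.add_len_le i, q.len_nonneg]
    · linarith [hq.add_len_le i]
  · rintro (i | i) t ht <;> simp only [Sum.elim_inl, Sum.elim_inr]
    · rw [ArcPath.trans_toFun_left _ (by linarith [hp.add_len_le i, ht.2]), hp.toFun_add i t ht]
    · rw [add_assoc, ArcPath.trans_toFun_right _ (add_nonneg (hq.nonneg i) ht.1),
        hq.toFun_add i t ht]
  · rintro (i | i) (j | j) hij <;> simp only [Sum.elim_inl, Sum.elim_inr]
    · exact hp.pairwise (ne_of_apply_ne Sum.inl hij)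
    · rw [abs_sub_comm]
      exact (hbefore i j).trans (le_abs_self _)
    · exact (hbefore j i).trans (le_abs_self _)
    · rw [add_sub_add_left_eq_sub]
      exact hq.pairwise (ne_of_apply_ne Sum.inr hij)

theorem sub (h : IsCopyFamily w α s g) {a b : ℝ} (ha : 0 ≤ a) (hab : a ≤ b) (hb : b ≤ α.len)
    (hs : ∀ i, a ≤ s i ∧ s i + w.len ≤ b) :
    IsCopyFamily w (α.sub a b ha hab hb) (fun i => s i - a) g where
  nonneg i := sub_nonneg.2 (hs i).1
  add_len_le i := by
    simp only [ArcPath.sub]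
    linarith [(hs i).2]
  toFun_add i t ht := by
    rw [← h.toFun_add i t ht]
    simp only [ArcPath.sub]
    congr 1
    ring
  pairwise i j hij := by simpa only [sub_sub_sub_cancel_right] using h.pairwise hij

theorem card_filter_crossing_le_one [Fintype ι] (h : IsCopyFamily w α s g) (t : ℝ) :
    (Finset.univ.filter fun i => s i < t ∧ t < s i + w.len).card ≤ 1 := by
  refine Finset.card_le_one.2 fun i hi j hj => ?_
  obtain ⟨-, hi, hi'⟩ := Finset.mem_filter.1 hi
  obtain ⟨-, hj, hj'⟩ := Finset.mem_filter.1 hj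
  by_contra hne
  refine absurd (h.pairwise hne) (not_le.2 (abs_lt.2 ⟨?_, ?_⟩)) <;> linarith

theorem reverse (h : IsCopyFamily w α s g) :
    IsCopyFamily w.reverse α.reverse (fun i => α.len - s i - w.len) g where
  nonneg i := by linarith [h.add_len_le i]
  add_len_le i := by
    simp only [ArcPath.reverse]
    linarith [h.nonneg i]
  toFun_add i t ht := by
    have := h.toFun_add i (w.len - t) ⟨sub_nonneg.2 ht.2, sub_le_self _ ht.1⟩
    simp only [ArcPath.reverse]
    rw [← this]
    congr 1
    ring
  pairwise i j hij := by
    have : w.len ≤ |s i - s j| := h.pairwise hij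
    rwa [abs_sub_comm, ← sub_sub_sub_cancel_left _ _ α.len,
      ← sub_sub_sub_cancel_right _ _ w.len] at this

theorem smul [IsIsometricSMul Γ S] (h : IsCopyFamily w α s g) (γ : Γ) :
    IsCopyFamily w (α.smul γ) s fun i => γ * g i where
  nonneg := h.nonneg
  add_len_le := h.add_len_le
  toFun_add i t ht := by rw [mul_smul, ← h.toFun_add i t ht, ArcPath.smul]
  pairwise := h.pairwise

theorem self (w : ArcPath S) : IsCopyFamily w w (fun _ : Unit => 0) (fun _ => (1 : Γ)) := by
  refine ⟨?_, ?_, ?_, fun i j hij => absurd (Subsingleton.elim i j) hij⟩ <;> simp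

end IsCopyFamily

section PosLength

variable {w : ArcPath S} (hw : 0 < w.len)
include hw

theorem bddAbove_hasCopies (α : ArcPath S) : BddAbove {n | HasCopies Γ w α n} := by
  refine ⟨⌊α.len / w.len⌋₊, fun n hn => Nat.le_floor ?_⟩
  obtain ⟨s, g, h⟩ := hasCopies_iff.1 hn
  rw [le_div_iff₀ hw]
  simpa only [Fintype.card_fin] using h.card_mul_len_le hw

theorem exists_isCopyFamily_copyCount (α : ArcPath S) :
    ∃ (s : Fin (copyCount Γ w α) → ℝ) (g : Fin (copyCount Γ w α) → Γ), IsCopyFamily w α s g :=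
  hasCopies_iff.1 (Nat.sSup_mem
    ⟨0, hasCopies_iff.2 ⟨Fin.elim0, Fin.elim0, by constructor <;> exact fun i => i.elim0⟩⟩
    (bddAbove_hasCopies hw α))

theorem IsCopyFamily.card_le_copyCount {α : ArcPath S} {ι : Type*} [Fintype ι] {s : ι → ℝ}
    {g : ι → Γ} (h : IsCopyFamily w α s g) : Fintype.card ι ≤ copyCount Γ w α :=
  le_csSup (bddAbove_hasCopies hw α) h.hasCopies

theorem copyCount_mul_len_le (α : ArcPath S) : copyCount Γ w α * w.len ≤ α.len := by
  obtain ⟨s, g, h⟩ := exists_isCopyFamily_copyCount (Γ := Γ) hw α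
  simpa only [Fintype.card_fin] using h.card_mul_len_le hw

theorem one_le_copyCount_self : 1 ≤ copyCount Γ w w := by
  simpa only [Fintype.card_unit] using (IsCopyFamily.self (Γ := Γ) w).card_le_copyCount hw

theorem copyCount_add_le_trans {p q : ArcPath S} (h : p.toFun p.len = q.toFun 0) :
    copyCount Γ w p + copyCount Γ w q ≤ copyCount Γ w (p.trans q h) := by
  obtain ⟨s, g, hp⟩ := exists_isCopyFamily_copyCount (Γ := Γ) hw p
  obtain ⟨s', g', hq⟩ := exists_isCopyFamily_copyCount (Γ := Γ) hw q
  simpa only [Fintype.card_sum, Fintype.card_fin] using (hp.trans h hq).card_le_copyCount hw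

theorem copyCount_le_sub_add_sub (α : ArcPath S) {t : ℝ} (h₀ : 0 ≤ t) (ht : t ≤ α.len) :
    copyCount Γ w α ≤ copyCount Γ w (α.sub 0 t le_rfl h₀ ht)
      + copyCount Γ w (α.sub t α.len h₀ ht le_rfl) + 1 := by
  obtain ⟨s, g, h⟩ := exists_isCopyFamily_copyCount (Γ := Γ) hw α
  let before := Finset.univ.filter fun i => s i + w.len ≤ t
  let after := Finset.univ.filter fun i => t ≤ s i
  let crossing := Finset.univ.filter fun i => s i < t ∧ t < s i + w.len
  have hbefore : before.card ≤ copyCount Γ w (α.sub 0 t le_rfl h₀ ht) := by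
    simpa only [Fintype.card_coe] using
      ((h.comp_injective Subtype.val_injective).sub le_rfl h₀ ht fun i : before =>
        ⟨h.nonneg _, (Finset.mem_filter.1 i.2).2⟩).card_le_copyCount hw
  have hafter : after.card ≤ copyCount Γ w (α.sub t α.len h₀ ht le_rfl) := by
    simpa only [Fintype.card_coe] using
      ((h.comp_injective Subtype.val_injective).sub h₀ ht le_rfl fun i : after =>
        ⟨(Finset.mem_filter.1 i.2).2, h.add_len_le _⟩).card_le_copyCount hw
  have hcover : Finset.univ ⊆ before ∪ after ∪ crossing := by
    intro i _
    simp only [before, after, crossing, Finset.mem_union, Finset.mem_filter, Finset.mem_univ,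
      true_and, ← not_le]
    tauto
  have hcard := Finset.card_le_card hcover
  rw [Finset.card_univ, Fintype.card_fin] at hcard
  have hcrossing : crossing.card ≤ 1 := h.card_filter_crossing_le_one t
  have hunion := Finset.card_union_le (before ∪ after) crossing
  have hunion' := Finset.card_union_le before after
  omega

theorem copyCount_le_smul [IsIsometricSMul Γ S] (α : ArcPath S) (γ : Γ) :
    copyCount Γ w α ≤ copyCount Γ w (α.smul γ) := by
  obtain ⟨s, g, h⟩ := exists_isCopyFamily_copyCount (Γ := Γ) hw α
  simpa only [Fintype.card_fin] using (h.smul γ).card_le_copyCount hw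

end PosLength

theorem HasCopies.reverse {w α : ArcPath S} {n : ℕ} (h : HasCopies Γ w α n) :
    HasCopies Γ w.reverse α.reverse n := by
  obtain ⟨s, g, h⟩ := hasCopies_iff.1 h
  exact hasCopies_iff.2 ⟨_, _, h.reverse⟩

theorem copyCount_reverse (w α : ArcPath S) :
    copyCount Γ w.reverse α.reverse = copyCount Γ w α := by
  have (n : ℕ) : HasCopies Γ w.reverse α.reverse n ↔ HasCopies Γ w α n :=
    ⟨fun h => by simpa only [ArcPath.reverse_reverse] using h.reverse, HasCopies.reverse⟩
  simp only [copyCount, this]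

end CopyCount

section PathCost

variable (Γ : Type*) [Group Γ] {S : Type*} [MetricSpace S] [MulAction Γ S]

/-- The length `|α| - W |α|_w` of `α`, where every copy of `w` is discounted by `W`. -/
def reducedLength (w : ArcPath S) (W : ℝ) (α : ArcPath S) : ℝ :=
  α.len - W * copyCount Γ w α

/-- The infimum of the reduced lengths of the paths from `x` to `y`, which is the term subtracted
from `d(x, y)` in `countingFunction`. -/
def pathCost (w : ArcPath S) (W : ℝ) (x y : S) : ℝ :=
  sInf {b : ℝ | ∃ α : ArcPath S, α.Joins x y ∧ b = reducedLength Γ w W α}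

/-- The path `α` minimizes the reduced length among the paths with the same endpoints, up to the
additive error `c`. -/
def ArcPath.IsAlmostMinimizing (α w : ArcPath S) (W c : ℝ) : Prop :=
  reducedLength Γ w W α ≤ pathCost Γ w W (α.toFun 0) (α.toFun α.len) + c

/-- The antisymmetric function `(x, y) ↦ c_{w,W}(x, y) - c_{w⁻¹,W}(x, y)`, whose values on the
orbit of `x₀` give the Epstein--Fujiwara function `h_{w,W,x₀}`. -/
def costAsymmetry (w : ArcPath S) (W : ℝ) (x y : S) : ℝ :=
  pathCost Γ w W y x - pathCost Γ w W x y

variable {Γ} {w : ArcPath S} {W : ℝ}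

theorem reducedLength_le_len (hW : 0 ≤ W) (α : ArcPath S) : reducedLength Γ w W α ≤ α.len :=
  sub_le_self _ (by positivity)

theorem reducedLength_reverse (α : ArcPath S) :
    reducedLength Γ w.reverse W α.reverse = reducedLength Γ w W α := by
  rw [reducedLength, copyCount_reverse, reducedLength, ArcPath.reverse]

theorem pathCost_reverse (x y : S) : pathCost Γ w.reverse W x y = pathCost Γ w W y x := by
  unfold pathCost
  congr 1
  ext b
  constructor
  · rintro ⟨α, h, rfl⟩
    exact ⟨α.reverse, h.reverse, by
      rw [← reducedLength_reverse α.reverse, ArcPath.reverse_reverse]⟩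
  · rintro ⟨α, h, rfl⟩
    exact ⟨α.reverse, h.reverse, (reducedLength_reverse α).symm⟩

theorem epsteinFujiwara_eq_costAsymmetry (x₀ : S) (a : Γ) :
    epsteinFujiwara w W x₀ a = costAsymmetry Γ w W x₀ (a • x₀) := by
  have h (w : ArcPath S) :
      countingFunction Γ w W x₀ (a • x₀) = dist x₀ (a • x₀) - pathCost Γ w W x₀ (a • x₀) := rfl
  rw [epsteinFujiwara, h, h, pathCost_reverse, costAsymmetry]
  ring

theorem exists_reducedLength_lt (hgeo : GeodesicSpace S) {x y : S} {c : ℝ}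
    (h : pathCost Γ w W x y < c) :
    ∃ α : ArcPath S, α.Joins x y ∧ reducedLength Γ w W α < c := by
  obtain ⟨p, -, hp⟩ := hgeo x y
  obtain ⟨_, ⟨α, hα, rfl⟩, hlt⟩ := exists_lt_of_csInf_lt (s := {b : ℝ | ∃ α : ArcPath S,
    α.Joins x y ∧ b = reducedLength Γ w W α}) ⟨_, p, hp, rfl⟩ h
  exact ⟨α, hα, hlt⟩

theorem exists_isAlmostMinimizing (hgeo : GeodesicSpace S) {c : ℝ} (hc : 0 < c) (x y : S) :
    ∃ α : ArcPath S, α.Joins x y ∧ α.IsAlmostMinimizing Γ w W c := by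
  obtain ⟨α, hα, hlt⟩ := exists_reducedLength_lt (Γ := Γ) (w := w) (W := W) hgeo (x := x) (y := y)
    (lt_add_of_pos_right _ hc)
  exact ⟨α, hα, by rw [ArcPath.IsAlmostMinimizing, hα.1, hα.2]; exact hlt.le⟩

section PosLength

variable (hW : 0 < W)
include hW

theorem reducedLength_sub_add_sub_le (hw : 0 < w.len) (α : ArcPath S) {t : ℝ} (h₀ : 0 ≤ t)
    (ht : t ≤ α.len) :
    reducedLength Γ w W (α.sub 0 t le_rfl h₀ ht)
      + reducedLength Γ w W (α.sub t α.len h₀ ht le_rfl) ≤ reducedLength Γ w W α + W := by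
  have hcopies : (copyCount Γ w α : ℝ) ≤ copyCount Γ w (α.sub 0 t le_rfl h₀ ht)
      + copyCount Γ w (α.sub t α.len h₀ ht le_rfl) + 1 := by
    exact_mod_cast copyCount_le_sub_add_sub hw α h₀ ht
  have := mul_le_mul_of_nonneg_left hcopies hW.le
  simp only [reducedLength, ArcPath.sub] at this ⊢
  linarith

theorem len_le_two_mul_reducedLength (hw : 2 * W ≤ w.len) (α : ArcPath S) :
    α.len ≤ 2 * reducedLength Γ w W α := by
  have hle : (copyCount Γ w α : ℝ) * (2 * W) ≤ copyCount Γ w α * w.len := by gcongr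
  have := copyCount_mul_len_le (Γ := Γ) (show 0 < w.len by linarith) α
  rw [reducedLength]
  linarith

variable (hw : W ≤ w.len)
include hw

theorem reducedLength_nonneg (α : ArcPath S) : 0 ≤ reducedLength Γ w W α := by
  have hle : W * copyCount Γ w α ≤ w.len * copyCount Γ w α := by gcongr
  have := copyCount_mul_len_le (Γ := Γ) (hW.trans_le hw) α
  rw [reducedLength]
  linarith

theorem pathCost_le_reducedLength {x y : S} {α : ArcPath S} (h : α.Joins x y) :
    pathCost Γ w W x y ≤ reducedLength Γ w W α := by
  refine csInf_le ⟨0, ?_⟩ ⟨α, h, rfl⟩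
  rintro _ ⟨β, -, rfl⟩
  exact reducedLength_nonneg hW hw β

theorem pathCost_add_pathCost_le {x y : S} {α : ArcPath S} (h : α.Joins x y) {t : ℝ}
    (ht : t ∈ Icc 0 α.len) :
    pathCost Γ w W x (α.toFun t) + pathCost Γ w W (α.toFun t) y ≤ reducedLength Γ w W α + W := by
  have hleft := pathCost_le_reducedLength (Γ := Γ) hW hw (α.sub_joins le_rfl ht.1 ht.2)
  have hright := pathCost_le_reducedLength (Γ := Γ) hW hw (α.sub_joins ht.1 ht.2 le_rfl)
  rw [h.1] at hleft
  rw [h.2] at hright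
  linarith [reducedLength_sub_add_sub_le (Γ := Γ) hW (hW.trans_le hw) α ht.1 ht.2]

section Geodesic

variable (hgeo : GeodesicSpace S)
include hgeo

theorem pathCost_le_dist (x y : S) : pathCost Γ w W x y ≤ dist x y := by
  obtain ⟨p, hp, hj⟩ := hgeo x y
  rw [← hp.len_eq hj]
  exact (pathCost_le_reducedLength hW hw hj).trans (reducedLength_le_len hW.le p)

theorem pathCost_triangle (x y z : S) :
    pathCost Γ w W x z ≤ pathCost Γ w W x y + pathCost Γ w W y z := by
  refine le_of_forall_pos_le_add fun ε hε => ?_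
  obtain ⟨α, hα, hαlt⟩ := exists_reducedLength_lt (Γ := Γ) (w := w) (W := W) hgeo (x := x) (y := y)
    (lt_add_of_pos_right _ (half_pos hε))
  obtain ⟨β, hβ, hβlt⟩ := exists_reducedLength_lt (Γ := Γ) (w := w) (W := W) hgeo (x := y) (y := z)
    (lt_add_of_pos_right _ (half_pos hε))
  have hle := pathCost_le_reducedLength (Γ := Γ) hW hw (hα.trans hβ)
  have hcopies : (copyCount Γ w α : ℝ) + copyCount Γ w β ≤
      copyCount Γ w (α.trans β (hα.2.trans hβ.1.symm)) := by
    exact_mod_cast copyCount_add_le_trans (hW.trans_le hw) (hα.2.trans hβ.1.symm)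
  have := mul_le_mul_of_nonneg_left hcopies hW.le
  have hlen : (α.trans β (hα.2.trans hβ.1.symm)).len = α.len + β.len := rfl
  simp only [reducedLength] at hle hαlt hβlt
  linarith

theorem pathCost_smul [IsIsometricSMul Γ S] (γ : Γ) (x y : S) :
    pathCost Γ w W (γ • x) (γ • y) = pathCost Γ w W x y := by
  have hle (γ : Γ) (x y : S) : pathCost Γ w W (γ • x) (γ • y) ≤ pathCost Γ w W x y := by
    refine le_of_forall_pos_le_add fun ε hε => ?_
    obtain ⟨α, hα, hlt⟩ := exists_reducedLength_lt (Γ := Γ) (w := w) (W := W) hgeo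
      (x := x) (y := y) (lt_add_of_pos_right _ hε)
    have hcopies : (copyCount Γ w α : ℝ) ≤ copyCount Γ w (α.smul γ) := by
      exact_mod_cast copyCount_le_smul (hW.trans_le hw) α γ
    have hlen : (α.smul γ).len = α.len := rfl
    have hcost := pathCost_le_reducedLength (Γ := Γ) hW hw (hα.smul γ)
    have := mul_le_mul_of_nonneg_left hcopies hW.le
    simp only [reducedLength] at hcost hlt
    linarith
  refine (hle γ x y).antisymm ?_
  simpa only [inv_smul_smul] using hle γ⁻¹ (γ • x) (γ • y)

end Geodesic

end PosLength

namespace ArcPath.IsAlmostMinimizing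

variable {c : ℝ} {α : ArcPath S}

section Sub

variable (hα : α.IsAlmostMinimizing Γ w W c) (hgeo : GeodesicSpace S) (hW : 0 < W)
  (hw : W ≤ w.len) {t : ℝ} (h₀ : 0 ≤ t) (ht : t ≤ α.len)
include hα hgeo hW hw

theorem sub_left : (α.sub 0 t le_rfl h₀ ht).IsAlmostMinimizing Γ w W (c + W) := by
  have hright := pathCost_le_reducedLength (Γ := Γ) hW hw (α.sub_joins h₀ ht le_rfl)
  have hj := α.sub_joins le_rfl h₀ ht
  rw [IsAlmostMinimizing] at hα ⊢
  rw [hj.1, hj.2]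
  linarith [reducedLength_sub_add_sub_le (Γ := Γ) hW (hW.trans_le hw) α h₀ ht,
    pathCost_triangle (Γ := Γ) hW hw hgeo (α.toFun 0) (α.toFun t) (α.toFun α.len)]

theorem sub_right : (α.sub t α.len h₀ ht le_rfl).IsAlmostMinimizing Γ w W (c + W) := by
  have hleft := pathCost_le_reducedLength (Γ := Γ) hW hw (α.sub_joins le_rfl h₀ ht)
  have hj := α.sub_joins h₀ ht le_rfl
  rw [IsAlmostMinimizing] at hα ⊢
  rw [hj.1, hj.2]
  linarith [reducedLength_sub_add_sub_le (Γ := Γ) hW (hW.trans_le hw) α h₀ ht,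
    pathCost_triangle (Γ := Γ) hW hw hgeo (α.toFun 0) (α.toFun t) (α.toFun α.len)]

end Sub

theorem isQuasigeodesic (hα : α.IsAlmostMinimizing Γ w W c) (hgeo : GeodesicSpace S)
    (hW : 0 < W) (hw : 2 * W ≤ w.len) : α.IsQuasigeodesic 2 (4 * W + 2 * c) := by
  intro s hs t ht
  wlog hst : s ≤ t generalizing s t
  · rw [abs_sub_comm, dist_comm]
    exact this t ht s hs (le_of_not_ge hst)
  have hw' : W ≤ w.len := by linarith
  have hts : t - s ≤ (α.sub s α.len hs.1 hs.2 le_rfl).len := sub_le_sub_right ht.2 s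
  let β := (α.sub s α.len hs.1 hs.2 le_rfl).sub 0 (t - s) le_rfl (sub_nonneg.2 hst) hts
  have hβ : β.IsAlmostMinimizing Γ w W (c + W + W) :=
    (hα.sub_right hgeo hW hw' hs.1 hs.2).sub_left hgeo hW hw' (sub_nonneg.2 hst) hts
  have hj : β.Joins (α.toFun s) (α.toFun t) := by
    constructor <;> simp [β, ArcPath.sub]
  have hlen : β.len = t - s := sub_zero _
  rw [IsAlmostMinimizing, hj.1, hj.2] at hβ
  rw [abs_sub_comm, abs_of_nonneg (sub_nonneg.2 hst)]
  linarith [len_le_two_mul_reducedLength (Γ := Γ) hW hw β,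
    pathCost_le_dist (Γ := Γ) hW hw' hgeo (α.toFun s) (α.toFun t)]

end ArcPath.IsAlmostMinimizing

/-- A bound for the amount by which `pathCost` fails to be additive at a point that is between the
two endpoints up to the error `C`, in a space satisfying the four-point condition with constant
`Δ`. -/
def pathCostExcess (Δ W C : ℝ) : ℝ := 1 + W + 2 * (C + Δ + stabilityRadius Δ 2 (4 * W + 2))

theorem pathCostExcess_nonneg {Δ C : ℝ} (hΔ : 0 ≤ Δ) (hW : 0 ≤ W) (hC : 0 ≤ C) :
    0 ≤ pathCostExcess Δ W C := by
  have := stabilityRadius_nonneg hΔ zero_le_two (4 * W + 2)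
  unfold pathCostExcess
  positivity

section Hyperbolic

variable {Δ C : ℝ} (hgeo : GeodesicSpace S) (hΔ : FourPoint Δ S) (hW : 0 < W)
  (hw : 2 * W ≤ w.len)
include hgeo hΔ hW hw

theorem pathCost_add_le_of_almostBetween (hC : 0 ≤ C) {x p z : S} (hp : AlmostBetween C x p z) :
    pathCost Γ w W x p + pathCost Γ w W p z ≤ pathCost Γ w W x z + pathCostExcess Δ W C := by
  have hw' : W ≤ w.len := by linarith
  obtain ⟨α, hj, hα⟩ := exists_isAlmostMinimizing (Γ := Γ) (w := w) (W := W) hgeo one_pos x z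
  have hquasi := hα.isQuasigeodesic hgeo hW hw
  rw [mul_one] at hquasi
  obtain ⟨s, hs, hps⟩ := hquasi.exists_dist_le_of_almostBetween hgeo hΔ zero_le_two hj hC hp
  have htri := pathCost_triangle (Γ := Γ) hW hw' hgeo
  have hdist := pathCost_le_dist (Γ := Γ) hW hw' hgeo
  rw [ArcPath.IsAlmostMinimizing, hj.1, hj.2] at hα
  unfold pathCostExcess
  linarith [pathCost_add_pathCost_le (Γ := Γ) hW hw' hj hs, htri x (α.toFun s) p,
    htri p (α.toFun s) z, hdist (α.toFun s) p, hdist p (α.toFun s), dist_comm p (α.toFun s)]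

theorem abs_costAsymmetry_add_sub_le (hC : 0 ≤ C) {x p z : S} (hp : AlmostBetween C x p z) :
    |costAsymmetry Γ w W x p + costAsymmetry Γ w W p z - costAsymmetry Γ w W x z|
      ≤ pathCostExcess Δ W C := by
  have htri := pathCost_triangle (Γ := Γ) hW (by linarith) hgeo (w := w)
  have hle := pathCost_add_le_of_almostBetween (Γ := Γ) hgeo hΔ hW hw hC hp
  have hle' := pathCost_add_le_of_almostBetween (Γ := Γ) hgeo hΔ hW hw hC hp.symm
  simp only [costAsymmetry]
  rw [abs_le]
  constructor <;> linarith [htri x p z, htri z p x]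

theorem abs_costAsymmetry_cocycle_le (x y z : S) :
    |costAsymmetry Γ w W x y + costAsymmetry Γ w W y z - costAsymmetry Γ w W x z|
      ≤ 3 * pathCostExcess Δ W Δ := by
  have : Nonempty S := ⟨x⟩
  obtain ⟨γ, hγ, hj⟩ := hgeo x y
  obtain ⟨t, ht, hxz, hyz⟩ := hΔ.exists_center hγ hj z
  have hxy : AlmostBetween Δ x (γ.toFun t) y := by
    linarith [hγ.dist_left hj ht, hγ.dist_right hj ht, hγ.len_eq hj, hΔ.nonneg]
  have hsplit {u v : S} := abs_costAsymmetry_add_sub_le (Γ := Γ) hgeo hΔ hW hw hΔ.nonneg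
    (x := u) (p := γ.toFun t) (z := v)
  have hxy := abs_le.1 (hsplit hxy)
  have hyz := abs_le.1 (hsplit hyz)
  have hxz := abs_le.1 (hsplit hxz)
  have hanti : costAsymmetry Γ w W y (γ.toFun t) = -costAsymmetry Γ w W (γ.toFun t) y :=
    (neg_sub _ _).symm
  rw [abs_le]
  constructor <;> linarith

theorem abs_epsteinFujiwara_mul_sub_le [IsIsometricSMul Γ S] (x₀ : S) (a b : Γ) :
    |epsteinFujiwara w W x₀ (a * b) - (epsteinFujiwara w W x₀ a + epsteinFujiwara w W x₀ b)|
      ≤ 3 * pathCostExcess Δ W Δ := by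
  have hsmul : costAsymmetry Γ w W x₀ (b • x₀) =
      costAsymmetry Γ w W (a • x₀) ((a * b) • x₀) := by
    rw [mul_smul, costAsymmetry, costAsymmetry, pathCost_smul hW (by linarith) hgeo,
      pathCost_smul hW (by linarith) hgeo]
  simp only [epsteinFujiwara_eq_costAsymmetry]
  rw [hsmul, abs_sub_comm]
  exact abs_costAsymmetry_cocycle_le hgeo hΔ hW hw _ _ _

end Hyperbolic

end PathCost

section ReversedCopies

theorem injective_twist_of_not_isAchiral {Γ : Type*} [Group Γ] {g : Γ} (hg : ¬ IsAchiral g)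
    (γ : Γ) : Function.Injective fun i : ℕ => (g ^ i)⁻¹ * γ * (g ^ i)⁻¹ * γ⁻¹ := by
  refine .of_lt_imp_ne fun i j hij h => hg ?_
  obtain ⟨m, rfl⟩ := Nat.exists_eq_add_of_le hij.le
  refine ⟨m, by omega, isConj_iff.2 ⟨γ⁻¹, ?_⟩⟩
  have hconj : g ^ m * γ = γ * (g ^ m)⁻¹ := calc
    g ^ m * γ = g ^ (i + m) * ((g ^ i)⁻¹ * γ * (g ^ i)⁻¹) * g ^ i := by
      rw [add_comm, pow_add]
      group
    _ = g ^ (i + m) * ((g ^ (i + m))⁻¹ * γ * (g ^ (i + m))⁻¹) * g ^ i := by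
      rw [mul_right_cancel h]
    _ = γ * (g ^ m)⁻¹ := by
      rw [pow_add]
      group
  rw [inv_inv, mul_assoc, hconj, inv_mul_cancel_left]

variable {Γ : Type*} [Group Γ] {S : Type*} [MetricSpace S] [MulAction Γ S]

section ReversedSegment

variable [IsIsometricSMul Γ S] [Nonempty S] {Δ A B : ℝ} {g γ : Γ} {x : S} {n M : ℕ}

theorem IsAxisPoint.dist_smul_pow_smul_le (hx : IsAxisPoint B g x) (hΔ : FourPoint Δ S)
    (hrev : dist x (γ • g ^ M • x) + dist (γ • g ^ M • x) (γ • x) + dist (γ • x) (g ^ n • x)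
      ≤ dist x (g ^ n • x) + A) {l i : ℕ} (hli : l + i ≤ M) :
    dist (γ • g ^ l • x) (g ^ i • γ • g ^ (l + i) • x) ≤ 5 * B + A + Δ := by
  obtain ⟨k, rfl⟩ := Nat.exists_eq_add_of_le hli
  have hB := hx.nonneg
  set τ := translationLength S g
  have hle (j i : ℕ) : dist (γ • g ^ (j + i) • x) (γ • g ^ j • x) ≤ i * τ + B := by
    rw [dist_comm, dist_smul, dist_pow_smul_pow_smul]
    exact hx.dist_pow_smul_le i
  have htail : dist (γ • g ^ (l + i + k) • x) (γ • g ^ l • x) ≤ (i + k) * τ + B := by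
    simpa only [add_assoc, Nat.cast_add] using hle l (i + k)
  have hhead : dist (γ • g ^ l • x) (γ • x) ≤ l * τ + B := by simpa using hle 0 l
  have hhead' : dist (γ • g ^ (l + i) • x) (γ • x) ≤ (l + i) * τ + B := by
    simpa using hle 0 (l + i)
  have htotal : (l + i + k) * τ ≤ dist (γ • g ^ (l + i + k) • x) (γ • x) := by
    rw [dist_smul, dist_comm]
    exact_mod_cast mul_translationLength_le g x (l + i + k)
  have hlower : (n + i) * τ ≤ dist x (g ^ i • g ^ n • x) := by
    rw [smul_smul, ← pow_add, add_comm i]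
    exact_mod_cast mul_translationLength_le g x (n + i)
  have hstart : dist x (g ^ i • γ • g ^ (l + i) • x) ≤
      i * τ + B + dist x (γ • g ^ (l + i) • x) := by
    linarith [dist_triangle x (g ^ i • x) (g ^ i • γ • g ^ (l + i) • x), hx.dist_pow_smul_le i,
      dist_smul (g ^ i) x (γ • g ^ (l + i) • x)]
  have hend : dist (g ^ i • g ^ n • x) (g ^ n • x) ≤ i * τ + B := by
    rw [dist_comm, dist_smul_smul_of_commute ((Commute.refl g).pow_pow i n)]
    exact hx.dist_pow_smul_le i
  have hshift := dist_smul (g ^ i) (g ^ n • x) (γ • g ^ (l + i) • x)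
  rcases hΔ.le_or_le x (g ^ i • g ^ n • x) (γ • g ^ l • x) (g ^ i • γ • g ^ (l + i) • x)
    with h | h <;>
  linarith [hx.dist_pow_smul_le n, hle (l + i) k,
    dist_triangle x (γ • g ^ (l + i + k) • x) (γ • g ^ l • x),
    dist_triangle x (γ • g ^ (l + i + k) • x) (γ • g ^ (l + i) • x),
    dist_triangle_right (γ • g ^ (l + i) • x) (g ^ n • x) (γ • x),
    dist_triangle4 (g ^ i • g ^ n • x) (g ^ n • x) (γ • x) (γ • g ^ l • x),
    dist_comm (γ • x) (g ^ n • x), dist_comm (γ • g ^ l • x) (γ • x),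
    dist_comm (g ^ n • x) (γ • g ^ (l + i) • x)]

theorem AcylindricalWith.isAchiral_of_reversed_segment {R : ℝ → ℝ} {N : ℝ → ℕ}
    (hac : AcylindricalWith Γ S R N) (hΔ : FourPoint Δ S) (hx : IsAxisPoint B g x) {r : ℝ}
    (hr : 0 < r) (hr' : 5 * B + A + Δ ≤ r) (hM : N r ≤ M)
    (hR : R r ≤ (M - N r) * translationLength S g)
    (hrev : dist x (γ • g ^ M • x) + dist (γ • g ^ M • x) (γ • x) + dist (γ • x) (g ^ n • x)
      ≤ dist x (g ^ n • x) + A) : IsAchiral g := by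
  by_contra hg
  have hclose : ∀ i j, i ≤ j → j ≤ M →
      dist (γ • g ^ j • x) (((g ^ i)⁻¹ * γ * (g ^ i)⁻¹ * γ⁻¹) • γ • g ^ j • x) ≤ r := by
    intro i j hij hj
    obtain ⟨l, rfl⟩ := Nat.exists_eq_add_of_le' hij
    have hact : ((g ^ i)⁻¹ * γ * (g ^ i)⁻¹ * γ⁻¹) • γ • g ^ (l + i) • x =
        (g ^ i)⁻¹ • γ • g ^ l • x := by
      simp only [mul_smul, inv_smul_smul, add_comm l i, pow_add]
    rw [hact, ← dist_smul (g ^ i), smul_inv_smul, dist_comm]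
    exact (hx.dist_smul_pow_smul_le hΔ hrev hj).trans hr'
  have hfar : R r ≤ dist (γ • g ^ M • x) (γ • g ^ N r • x) := by
    have hlower := mul_translationLength_le g x (M - N r)
    rw [Nat.cast_sub hM] at hlower
    rw [dist_smul, dist_comm, ← Nat.add_sub_of_le hM, dist_pow_smul_pow_smul]
    exact hR.trans hlower
  exact hac.not_injOn hr hfar (fun i hi => hclose i M (hi.trans hM) le_rfl)
    (fun i hi => hclose i (N r) hi hM) (injective_twist_of_not_isAchiral hg γ).injOn

end ReversedSegment

theorem ArcPath.IsQuasigeodesic.dist_add_dist_add_dist_le {Δ lam k : ℝ} {α : ArcPath S}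
    (hα : α.IsQuasigeodesic lam k) (hgeo : GeodesicSpace S) (hΔ : FourPoint Δ S) (hlam : 0 ≤ lam)
    {s t : ℝ} (hs : 0 ≤ s) (hst : s ≤ t) (ht : t ≤ α.len) :
    dist (α.toFun 0) (α.toFun s) + dist (α.toFun s) (α.toFun t) +
        dist (α.toFun t) (α.toFun α.len) ≤
      dist (α.toFun 0) (α.toFun α.len) + 4 * ((1 + 2 * lam) * stabilityRadius Δ lam k + k) := by
  have hfirst := hα.almostBetween hgeo hΔ hlam ⟨hs, hst.trans ht⟩
  have hsecond := (hα.sub hs (hst.trans ht) le_rfl).almostBetween hgeo hΔ hlam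
    (s := t - s) ⟨sub_nonneg.2 hst, sub_le_sub_right ht s⟩
  simp only [ArcPath.sub, add_zero, add_sub_cancel] at hsecond
  linarith

theorem exists_smul_copy_of_reducedLength_lt_len {w α : ArcPath S} {W : ℝ} (hw : 0 < w.len)
    (h : reducedLength Γ w W α < α.len) :
    ∃ (s : ℝ) (γ : Γ), 0 ≤ s ∧ s + w.len ≤ α.len ∧
      ∀ t ∈ Icc 0 w.len, α.toFun (s + t) = γ • w.toFun t := by
  obtain ⟨s, g, hcopies⟩ := exists_isCopyFamily_copyCount (Γ := Γ) hw α
  have hpos : copyCount Γ w α ≠ 0 := by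
    intro h0
    rw [reducedLength, h0, Nat.cast_zero, mul_zero, sub_zero] at h
    exact h.false
  let i : Fin (copyCount Γ w α) := ⟨0, Nat.pos_of_ne_zero hpos⟩
  exact ⟨s i, g i, hcopies.nonneg i, hcopies.add_len_le i, hcopies.toFun_add i⟩

/-- A scale at which acylindricity excludes that an almost minimizing path along the axis of a
chiral element `g`, with axis constant `B`, contains a copy of a long segment of the axis of `g`
with the opposite orientation. -/
def reversalScale (Δ W B : ℝ) : ℝ :=
  5 * B + 4 * ((1 + 2 * 2) * stabilityRadius Δ 2 (4 * W + 2) + (4 * W + 2)) + Δ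

theorem AcylindricalWith.dist_le_pathCost_reverse [IsIsometricSMul Γ S] [Nonempty S]
    {R : ℝ → ℝ} {N : ℝ → ℕ} (hac : AcylindricalWith Γ S R N) {Δ B W : ℝ} (hgeo : GeodesicSpace S)
    (hΔ : FourPoint Δ S) {g : Γ} {x : S} (hx : IsAxisPoint B g x) (hg : ¬ IsAchiral g) {M : ℕ}
    (hM : N (reversalScale Δ W B) ≤ M)
    (hR : R (reversalScale Δ W B) ≤ (M - N (reversalScale Δ W B)) * translationLength S g)
    {w : ArcPath S} (hj : w.Joins x (g ^ M • x)) (hW : 0 < W) (hw : 2 * W ≤ w.len) (n : ℕ) :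
    dist x (g ^ n • x) ≤ pathCost Γ w.reverse W x (g ^ n • x) := by
  by_contra! hlt
  have hB := hx.nonneg
  have hstab := stabilityRadius_nonneg hΔ.nonneg zero_le_two (4 * W + 2)
  have hr : 0 < reversalScale Δ W B := by
    have := hΔ.nonneg
    unfold reversalScale
    positivity
  have hwlen : 0 < w.reverse.len := lt_of_lt_of_le (by positivity) hw
  obtain ⟨α, hα, hαlt⟩ := exists_reducedLength_lt (Γ := Γ) (w := w.reverse) (W := W) hgeo
    (lt_min hlt (lt_add_of_pos_right _ one_pos))
  obtain ⟨hshort, hmin⟩ := lt_min_iff.1 hαlt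
  obtain ⟨s, γ, hs, hs', hcopy⟩ :=
    exists_smul_copy_of_reducedLength_lt_len hwlen (hshort.trans_le hα.dist_le)
  have hstart : α.toFun s = γ • g ^ M • x := by
    simpa only [add_zero, hj.reverse.1] using hcopy 0 ⟨le_rfl, hwlen.le⟩
  have hend : α.toFun (s + w.reverse.len) = γ • x := by
    rw [hcopy _ ⟨hwlen.le, le_rfl⟩, hj.reverse.2]
  have hαmin : α.IsAlmostMinimizing Γ w.reverse W 1 := by
    rw [ArcPath.IsAlmostMinimizing, hα.1, hα.2]
    exact hmin.le
  have hquasi := hαmin.isQuasigeodesic hgeo hW hw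
  rw [mul_one] at hquasi
  have hrev := hquasi.dist_add_dist_add_dist_le hgeo hΔ zero_le_two hs
    (le_add_of_nonneg_right hwlen.le) hs'
  rw [hα.1, hα.2, hstart, hend] at hrev
  exact hg (hac.isAchiral_of_reversed_segment hΔ hx hr le_rfl hM hR hrev)

end ReversedCopies

section Quasimorphism

variable {Γ : Type*} [Group Γ]

/-- A quasimorphism with defect at most `E`. -/
def IsQuasimorphism (E : ℝ) (ψ : Γ → ℝ) : Prop :=
  ∀ a b : Γ, |ψ (a * b) - (ψ a + ψ b)| ≤ E

namespace IsQuasimorphism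

variable {ψ : Γ → ℝ} {E : ℝ} (hψ : IsQuasimorphism E ψ)
include hψ

theorem abs_one_le : |ψ 1| ≤ E := by
  have := hψ 1 1
  rwa [mul_one, sub_add_cancel_left, abs_neg] at this

theorem abs_pow_sub_le (g : Γ) (n : ℕ) : |ψ (g ^ n) - n * ψ g| ≤ (n + 1) * E := by
  induction n with
  | zero => simpa using hψ.abs_one_le
  | succ n ih =>
    have := hψ (g ^ n) g
    rw [← pow_succ] at this
    rw [abs_le] at this ih ⊢
    push_cast
    constructor <;> linarith

theorem tendsto_homogenization (g : Γ) :
    Tendsto (fun n : ℕ => ψ (g ^ n) / n) atTop (𝓝 (homogenization ψ g)) := by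
  have hsub : Subadditive fun n : ℕ => ψ (g ^ n) + E := by
    intro m n
    have := (abs_le.1 (hψ (g ^ m) (g ^ n))).2
    rw [← pow_add] at this
    linarith
  have hbdd : BddBelow (range fun n : ℕ => (ψ (g ^ n) + E) / n) := by
    refine ⟨min 0 (ψ g - E), ?_⟩
    rintro _ ⟨n, rfl⟩
    rcases n.eq_zero_or_pos with rfl | hn
    · simp
    · refine (min_le_right _ _).trans ?_
      rw [le_div_iff₀ (by positivity)]
      linarith [(abs_le.1 (hψ.abs_pow_sub_le g n)).1]
  refine tendsto_nhds_limUnder ⟨_, ((hsub.tendsto_lim hbdd).sub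
    (tendsto_const_div_atTop_nhds_zero_nat E)).congr fun n => ?_⟩
  rw [← sub_div, add_sub_cancel_right]

theorem abs_homogenization_sub_le (g : Γ) : |homogenization ψ g - ψ g| ≤ E := by
  have hbound : Tendsto (fun n : ℕ => E + E / n) atTop (𝓝 (E + 0)) :=
    tendsto_const_nhds.add (tendsto_const_div_atTop_nhds_zero_nat E)
  rw [add_zero] at hbound
  refine le_of_tendsto_of_tendsto ((hψ.tendsto_homogenization g).sub_const (ψ g)).abs hbound ?_
  filter_upwards [eventually_gt_atTop 0] with n hn
  have hn' : (0 : ℝ) < n := Nat.cast_pos.2 hn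
  rw [div_sub' hn'.ne', abs_div, Nat.abs_cast, div_le_iff₀ hn', add_mul, div_mul_cancel₀ _ hn'.ne']
  linarith [hψ.abs_pow_sub_le g n]

theorem abs_le_abs_homogenization_add (g : Γ) : |ψ g| ≤ |homogenization ψ g| + E := by
  have := abs_sub_abs_le_abs_sub (ψ g) (homogenization ψ g)
  rw [abs_sub_comm] at this
  linarith [hψ.abs_homogenization_sub_le g]

theorem homogenization_pow (g : Γ) (m : ℕ) :
    homogenization ψ (g ^ m) = m * homogenization ψ g := by
  refine tendsto_nhds_unique (hψ.tendsto_homogenization (g ^ m)) ?_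
  simpa only [pow_mul] using tendsto_mul_div (hψ.tendsto_homogenization g) m

theorem abs_list_prod_le {c : ℝ} {l : List Γ} (hl : ∀ a ∈ l, |ψ a| ≤ c) :
    |ψ l.prod| ≤ l.length * (c + E) + E := by
  induction l with
  | nil => simpa using hψ.abs_one_le
  | cons a l ih =>
    have htail := ih fun b hb => hl b (List.mem_cons_of_mem _ hb)
    have hhead := hl a List.mem_cons_self
    have hmul := hψ a l.prod
    rw [List.prod_cons, List.length_cons]
    push_cast
    rw [abs_le] at htail hhead hmul ⊢
    constructor <;> linarith

end IsQuasimorphism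

end Quasimorphism

section WordNorm

variable {Γ : Type*} [Group Γ] {A : Set Γ} {g : Γ}

theorem wordNorm_list_prod_le {l : List Γ} (hl : ∀ a ∈ l, a ∈ A) : wordNorm A l.prod ≤ l.length :=
  Nat.sInf_le ⟨l, rfl, hl, rfl⟩

theorem exists_list_length_eq_wordNorm (hA : ∀ a ∈ A, a⁻¹ ∈ A) (hg : g ∈ Subgroup.closure A) :
    ∃ l : List Γ, l.length = wordNorm A g ∧ (∀ a ∈ l, a ∈ A) ∧ l.prod = g := by
  have hA' : A ∪ A⁻¹ = A := union_eq_left.2 fun a ha => inv_inv a ▸ hA _ (mem_inv.1 ha)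
  rw [← Subgroup.mem_toSubmonoid, Subgroup.closure_toSubmonoid, hA'] at hg
  obtain ⟨l, hl, hprod⟩ := Submonoid.exists_list_of_mem_closure hg
  exact Nat.sInf_mem (s := {n | ∃ l : List Γ, l.length = n ∧ (∀ a ∈ l, a ∈ A) ∧ l.prod = g})
    ⟨l.length, l, rfl, hl, hprod⟩

theorem wordNorm_mul_le (hA : ∀ a ∈ A, a⁻¹ ∈ A) {h : Γ} (hg : g ∈ Subgroup.closure A)
    (hh : h ∈ Subgroup.closure A) : wordNorm A (g * h) ≤ wordNorm A g + wordNorm A h := by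
  obtain ⟨l, hlen, hl, rfl⟩ := exists_list_length_eq_wordNorm hA hg
  obtain ⟨l', hlen', hl', rfl⟩ := exists_list_length_eq_wordNorm hA hh
  rw [← hlen, ← hlen', ← List.length_append, ← List.prod_append]
  exact wordNorm_list_prod_le fun a ha => (List.mem_append.1 ha).elim (hl a) (hl' a)

theorem tendsto_stableWordNormAux (hA : ∀ a ∈ A, a⁻¹ ∈ A) (hg : g ∈ Subgroup.closure A) :
    Tendsto (fun n : ℕ => (wordNorm A (g ^ n) : ℝ) / n) atTop (𝓝 (stableWordNormAux A g)) := by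
  have hsub : Subadditive fun n : ℕ => (wordNorm A (g ^ n) : ℝ) := by
    intro m n
    simp only [pow_add]
    exact_mod_cast wordNorm_mul_le hA (pow_mem hg m) (pow_mem hg n)
  exact tendsto_nhds_limUnder ⟨_, hsub.tendsto_lim ⟨0, by rintro _ ⟨n, rfl⟩; positivity⟩⟩

theorem stableWordNormAux_eq_zero_of_forall_wordNorm_le (hA : ∀ a ∈ A, a⁻¹ ∈ A)
    (hg : g ∈ Subgroup.closure A) {m c : ℕ} (hm : 0 < m)
    (hc : ∀ n, wordNorm A (g ^ (m * n)) ≤ c) : stableWordNormAux A g = 0 := by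
  have hmul : m * stableWordNormAux A g = 0 := by
    refine tendsto_nhds_unique (tendsto_mul_div (tendsto_stableWordNormAux hA hg) m)
      (squeeze_zero (fun n => by positivity) (fun n => ?_)
        (tendsto_const_div_atTop_nhds_zero_nat (c : ℝ)))
    gcongr
    exact_mod_cast hc n
  exact (mul_eq_zero.1 hmul).resolve_left (Nat.cast_ne_zero.2 hm.ne')

theorem exists_stableWordNorm_eq (h : ∃ m : ℕ, 0 < m ∧ g ^ m ∈ Subgroup.closure A) :
    ∃ m : ℕ, 0 < m ∧ g ^ m ∈ Subgroup.closure A ∧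
      stableWordNorm A g = ENNReal.ofReal (stableWordNormAux A (g ^ m) / m) := by
  classical
  rw [stableWordNorm, dif_pos h]
  exact ⟨_, (Nat.find_spec h).1, (Nat.find_spec h).2, rfl⟩

theorem IsQuasimorphism.abs_homogenization_le_stableWordNormAux_mul {ψ : Γ → ℝ} {E C : ℝ}
    (hψ : IsQuasimorphism E ψ) (hA : ∀ a ∈ A, a⁻¹ ∈ A) (hC : ∀ a ∈ A, |homogenization ψ a| ≤ C)
    (hg : g ∈ Subgroup.closure A) :
    |homogenization ψ g| ≤ stableWordNormAux A g * (C + 2 * E) := by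
  have hlim := ((tendsto_stableWordNormAux hA hg).mul_const (C + 2 * E)).add
    (tendsto_const_div_atTop_nhds_zero_nat E)
  rw [add_zero] at hlim
  refine le_of_tendsto_of_tendsto (hψ.tendsto_homogenization g).abs hlim (.of_forall fun n => ?_)
  obtain ⟨l, hlen, hl, hprod⟩ := exists_list_length_eq_wordNorm hA (pow_mem hg n)
  have hword := hψ.abs_list_prod_le (l := l) (c := C + E) fun a ha =>
    (hψ.abs_le_abs_homogenization_add a).trans (by gcongr; exact hC a (hl a ha))
  rw [hlen, hprod, add_assoc C, ← two_mul] at hword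
  simp only [abs_div, Nat.abs_cast, div_mul_eq_mul_div, ← add_div]
  gcongr

theorem ofReal_div_le_stableWordNorm {ψ : Γ → ℝ} {E C : ℝ} (hψ : IsQuasimorphism E ψ)
    (hA : ∀ a ∈ A, a⁻¹ ∈ A) (hC : ∀ a ∈ A, |homogenization ψ a| ≤ C) (hCE : 0 < C + 2 * E) :
    ENNReal.ofReal (|homogenization ψ g| / (C + 2 * E)) ≤ stableWordNorm A g := by
  by_cases hpow : ∃ m : ℕ, 0 < m ∧ g ^ m ∈ Subgroup.closure A
  · obtain ⟨m, hm, hmem, heq⟩ := exists_stableWordNorm_eq hpow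
    have hbavard := hψ.abs_homogenization_le_stableWordNormAux_mul hA hC hmem
    rw [hψ.homogenization_pow, abs_mul, Nat.abs_cast] at hbavard
    rw [heq]
    refine ENNReal.ofReal_le_ofReal ?_
    rwa [div_le_div_iff₀ hCE (Nat.cast_pos.2 hm), mul_comm]
  · rw [stableWordNorm, dif_neg hpow]
    exact le_top

theorem pow_two_mul_eq_conj_mul_inv {t : Γ} (h : SemiconjBy t g g⁻¹) (n : ℕ) :
    g ^ (2 * n) = g ^ n * t * (g ^ n)⁻¹ * t⁻¹ := by
  have hn : t * (g ^ n)⁻¹ = g ^ n * t := by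
    have := (h.pow_right n).inv_right
    rwa [inv_pow, inv_inv] at this
  rw [mul_assoc (g ^ n), hn, two_mul, pow_add]
  group

theorem stableWordNorm_eq_zero_of_semiconjBy_inv (hA : ∀ a ∈ A, a⁻¹ ∈ A)
    (hfin : ∀ a : Γ, IsOfFinOrder a → a ∈ A) {t : Γ} (ht : IsOfFinOrder t) {m : ℕ} (hm : 0 < m)
    (h : SemiconjBy t (g ^ m) (g ^ m)⁻¹) : stableWordNorm A g = 0 := by
  have hconj (n : ℕ) : (g ^ m) ^ n * t * ((g ^ m) ^ n)⁻¹ ∈ A :=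
    hfin _ ((MulAut.conj ((g ^ m) ^ n)).toMonoidHom.isOfFinOrder ht)
  have htA : t⁻¹ ∈ A := hA t (hfin t ht)
  have hmem : g ^ (m * 2) ∈ Subgroup.closure A := by
    rw [pow_mul, ← mul_one 2, pow_two_mul_eq_conj_mul_inv h]
    exact mul_mem (Subgroup.subset_closure (hconj 1)) (Subgroup.subset_closure htA)
  obtain ⟨k, -, hk, heq⟩ := exists_stableWordNorm_eq ⟨m * 2, by positivity, hmem⟩
  have hword (n : ℕ) : wordNorm A ((g ^ k) ^ (m * 2 * n)) ≤ 2 := by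
    have hpow : (g ^ k) ^ (m * 2 * n)
        = [(g ^ m) ^ (k * n) * t * ((g ^ m) ^ (k * n))⁻¹, t⁻¹].prod := by
      rw [List.prod_pair, ← pow_two_mul_eq_conj_mul_inv h, ← pow_mul, ← pow_mul]
      congr 1
      ring
    rw [hpow]
    exact wordNorm_list_prod_le (by simp [hconj, htA])
  rw [heq, stableWordNormAux_eq_zero_of_forall_wordNorm_le hA hk (by positivity) hword, zero_div,
    ENNReal.ofReal_zero]

end WordNorm

section PeriodicPath

variable {Γ : Type*} [Group Γ]

theorem IsQuasimorphism.le_mul_homogenization {ψ : Γ → ℝ} {E : ℝ} (hψ : IsQuasimorphism E ψ)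
    {g : Γ} {c : ℝ} {M : ℕ} (h : ∀ n : ℕ, n * c ≤ ψ (g ^ (M * n))) :
    c ≤ M * homogenization ψ g := by
  refine ge_of_tendsto (tendsto_mul_div (hψ.tendsto_homogenization g) M) ?_
  filter_upwards [eventually_gt_atTop 0] with n hn
  rw [le_div_iff₀ (Nat.cast_pos.2 hn), mul_comm]
  exact h n

variable {S : Type*} [MetricSpace S] [MulAction Γ S] {w : ArcPath S} {W : ℝ} {x : S}

theorem pathCost_le_len_sub (hW : 0 < W) (hw : W ≤ w.len) {y : S} (hj : w.Joins x y) :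
    pathCost Γ w W x y ≤ w.len - W := by
  refine (pathCost_le_reducedLength hW hw hj).trans
    (sub_le_sub_left (le_mul_of_one_le_right hW.le ?_) _)
  exact_mod_cast one_le_copyCount_self (hW.trans_le hw)

variable [IsIsometricSMul Γ S] {g : Γ}

theorem pathCost_pow_smul_le (hW : 0 < W) (hw : W ≤ w.len) (hgeo : GeodesicSpace S) (g : Γ) (x : S)
    (n : ℕ) : pathCost Γ w W x (g ^ n • x) ≤ n * pathCost Γ w W x (g • x) := by
  induction n with
  | zero => simpa using pathCost_le_dist (Γ := Γ) hW hw hgeo x x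
  | succ n ih =>
    have htri := pathCost_triangle (Γ := Γ) hW hw hgeo x (g ^ n • x) (g ^ (n + 1) • x)
    rw [pow_succ, mul_smul, pathCost_smul hW hw hgeo] at htri
    rw [pow_succ, mul_smul]
    push_cast
    linarith

variable [Nonempty S]

theorem mul_le_epsteinFujiwara_pow (hW : 0 < W) (hw : W ≤ w.len) (hgeo : GeodesicSpace S) {M : ℕ}
    (hj : w.Joins x (g ^ M • x)) {c : ℝ} (hc : w.len + c ≤ M * translationLength S g + W)
    (hrev : ∀ n : ℕ, dist x (g ^ n • x) ≤ pathCost Γ w.reverse W x (g ^ n • x)) (n : ℕ) :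
    n * c ≤ epsteinFujiwara w W x (g ^ (M * n)) := by
  have hperiod : pathCost Γ w W x (g ^ (M * n) • x) ≤ n * (M * translationLength S g - c) := by
    rw [pow_mul]
    refine (pathCost_pow_smul_le hW hw hgeo _ x n).trans ?_
    gcongr
    linarith [pathCost_le_len_sub (Γ := Γ) hW hw hj]
  have hdist := (mul_translationLength_le g x (M * n)).trans (hrev (M * n))
  rw [epsteinFujiwara_eq_costAsymmetry, costAsymmetry, ← pathCost_reverse]
  push_cast at hdist
  linarith

end PeriodicPath

section Gap

/-- The scale at which acylindricity is applied to reversed copies of `w`, when `W = K + 1` and the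
base point is an axis point up to `2 * K + 2 * (4 * δ)`. -/
def gapScale (δ K : ℝ) : ℝ := reversalScale (4 * δ) (K + 1) (2 * K + 2 * (4 * δ))

/-- The exponent `M` of the theorem. Since `1 ≤ N (2 * K + 2 * (4 * δ) + 1) * τ(g)` for loxodromic
`g`, it satisfies `max {T, 2K + 2, R r} ≤ (M - N r) τ(g)` with `r = gapScale δ K`. -/
def gapExponent (δ T K : ℝ) (R : ℝ → ℝ) (N : ℝ → ℕ) : ℕ :=
  N (gapScale δ K) + N (2 * K + 2 * (4 * δ) + 1) * ⌈max (max T (2 * K + 2)) (R (gapScale δ K))⌉₊ + 1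

/-- A bound for the defect of the quasimorphisms `h_{g^M}`. -/
def gapDefect (δ K : ℝ) : ℝ := 3 * pathCostExcess (4 * δ) (K + 1) (4 * δ)

theorem gapDefect_nonneg {δ K : ℝ} (hδ : 0 ≤ δ) (hK : 0 ≤ K) : 0 ≤ gapDefect δ K :=
  mul_nonneg zero_le_three (pathCostExcess_nonneg (by positivity) (by positivity) (by positivity))

variable {δ T K : ℝ} {Γ : Type u} [Group Γ] {S : Type v} [MetricSpace S] [Nonempty S]
  [MulAction Γ S] [IsIsometricSMul Γ S] (hTK : DisplacementConstants.{u, v} δ T K)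
  (hS : IsHyperbolic δ S) {R : ℝ → ℝ} {N : ℝ → ℕ} {g : Γ} {x : S}
include hTK hS

theorem DisplacementConstants.isAxisPoint (hg : T ≤ translationLength S g)
    (hx : AlmostMinimal δ g x) : IsAxisPoint K g x :=
  ⟨hTK.1.trans_le hg, fun n => (hTK.2.2 Γ S hS g hg x hx n).2⟩

theorem DisplacementConstants.exists_isAxisPoint_pow (hδ : 0 < δ) (hg : IsLoxodromic S g) :
    ∃ (p : ℕ) (x : S), IsAxisPoint K (g ^ p) x := by
  obtain ⟨p, hp⟩ := exists_nat_ge (T / translationLength S g)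
  rw [div_le_iff₀ hg, ← translationLength_pow] at hp
  obtain ⟨x, hx⟩ := exists_almostMinimal (S := S) hδ (g ^ p)
  exact ⟨p, x, hTK.isAxisPoint hS hp hx⟩

section Exponent

variable (hδ : 0 < δ) (hac : AcylindricalWith Γ S R N)
include hδ hac

theorem max_le_gapExponent_sub_mul_translationLength (hg : IsLoxodromic S g) :
    max (max T (2 * K + 2)) (R (gapScale δ K)) ≤
      (gapExponent δ T K R N - N (gapScale δ K)) * translationLength S g := by
  obtain ⟨p, x, hx⟩ := hTK.exists_isAxisPoint_pow hS hδ hg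
  have hone := hac.one_le_mul_translationLength (hx.of_pow (hS.fourPoint hδ.le))
  have hτ : 0 < translationLength S g := hg
  refine (Nat.le_ceil _).trans ?_
  rw [gapExponent]
  push_cast
  linarith [le_mul_of_one_le_right
    (Nat.cast_nonneg (α := ℝ) ⌈max (max T (2 * K + 2)) (R (gapScale δ K))⌉₊) hone]

theorem max_le_translationLength_pow_gapExponent (hg : IsLoxodromic S g) :
    max T (2 * K + 2) ≤ translationLength S (g ^ gapExponent δ T K R N) := by
  have hmax := (le_max_left _ _).trans
    (max_le_gapExponent_sub_mul_translationLength hTK hS hδ hac hg)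
  have hN := mul_nonneg (Nat.cast_nonneg (N (gapScale δ K))) (translationLength_nonneg (S := S) g)
  rw [translationLength_pow]
  linarith

theorem stableWordNorm_eq_zero_of_isAchiral {A : Set Γ} (hA : ∀ a ∈ A, a⁻¹ ∈ A)
    (hfin : ∀ a : Γ, IsOfFinOrder a → a ∈ A) (hg : IsLoxodromic S g) (hach : IsAchiral g) :
    stableWordNorm A g = 0 := by
  obtain ⟨m, hm, hconj⟩ := hach
  obtain ⟨t, ht⟩ := isConj_iff.1 hconj
  have hsemi : SemiconjBy t (g ^ m) (g ^ m)⁻¹ := mul_inv_eq_iff_eq_mul.1 ht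
  have hgm : IsLoxodromic S (g ^ m) := by
    rw [IsLoxodromic, translationLength_pow]
    exact mul_pos (Nat.cast_pos.2 hm) hg
  obtain ⟨p, x, hx⟩ := hTK.exists_isAxisPoint_pow hS hδ hgm
  have hinv : SemiconjBy t ((g ^ m) ^ p) ((g ^ m) ^ p)⁻¹ := by
    simpa only [inv_pow] using hsemi.pow_right p
  exact stableWordNorm_eq_zero_of_semiconjBy_inv hA hfin
    (hac.isOfFinOrder_of_inverts (hS.fourPoint hδ.le) hx hinv) hm hsemi

end Exponent

namespace Admissible

variable {M : ℕ} {w : ArcPath S} (h : Admissible δ T K M g x w)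
include h

theorem isAxisPoint (hδ : 0 ≤ δ) : IsAxisPoint (2 * K + 2 * (4 * δ)) g x := by
  obtain ⟨⟨m, -, hm, hx⟩, -⟩ := h
  exact (hTK.isAxisPoint hS ((le_max_left _ _).trans hm) hx).of_pow (hS.fourPoint hδ)

theorem len_le : w.len ≤ M * translationLength S g + K := by
  obtain ⟨⟨m, ⟨k, rfl⟩, hm, hx⟩, hw, hj⟩ := h
  have hk := (hTK.isAxisPoint hS ((le_max_left _ _).trans hm) hx).dist_pow_smul_le k
  rwa [← pow_mul, ← hw.len_eq hj, ← translationLength_pow, ← pow_mul, translationLength_pow] at hk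

omit hTK hS in
theorem two_mul_le_len (hM : 0 < M) (hK : 0 < K) : 2 * (K + 1) ≤ w.len := by
  obtain ⟨⟨m, ⟨k, rfl⟩, hm, -⟩, hw, hj⟩ := h
  have hk : (1 : ℝ) ≤ k := Nat.one_le_cast.2 (Nat.pos_of_mul_pos_left hM)
  calc 2 * (K + 1) ≤ k * (2 * K + 2) := by nlinarith
    _ ≤ k * translationLength S (g ^ m) := by gcongr; exact (le_max_right _ _).trans hm
    _ ≤ dist x ((g ^ m) ^ k • x) := mul_translationLength_le _ x k
    _ = w.len := by rw [← pow_mul, hw.len_eq hj]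

theorem isQuasimorphism (hδ : 0 ≤ δ) (hM : 0 < M) :
    IsQuasimorphism (gapDefect δ K) (epsteinFujiwara w (K + 1) x : Γ → ℝ) :=
  abs_epsteinFujiwara_mul_sub_le hS.geodesic (hS.fourPoint hδ) (by linarith [hTK.2.1])
    (h.two_mul_le_len hM hTK.2.1) x

end Admissible

section LowerBound

variable (hδ : 0 < δ) (hac : AcylindricalWith Γ S R N) (hch : ¬ IsAchiral g)
  {w : ArcPath S} (h : Admissible δ T K (gapExponent δ T K R N) g x w)
include hδ hac hch h

theorem Admissible.dist_le_pathCost_reverse (n : ℕ) :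
    dist x (g ^ n • x) ≤ pathCost Γ w.reverse (K + 1) x (g ^ n • x) := by
  have hx := h.isAxisPoint hTK hS hδ.le
  have hN : N (gapScale δ K) ≤ gapExponent δ T K R N := by
    rw [gapExponent, add_assoc]
    exact Nat.le_add_right _ _
  have hR := (le_max_right _ _).trans
    (max_le_gapExponent_sub_mul_translationLength hTK hS hδ hac hx.isLoxodromic)
  exact hac.dist_le_pathCost_reverse hS.geodesic (hS.fourPoint hδ.le) hx hch hN hR h.2.2
    (by linarith [hTK.2.1]) (h.two_mul_le_len (Nat.succ_pos _) hTK.2.1) n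

theorem Admissible.one_div_le_homogenization :
    1 / (gapExponent δ T K R N : ℝ) ≤
      homogenization (epsteinFujiwara w (K + 1) x : Γ → ℝ) g := by
  have hK := hTK.2.1
  have hM : 0 < gapExponent δ T K R N := Nat.succ_pos _
  have hlen := h.two_mul_le_len hM hK
  rw [div_le_iff₀' (Nat.cast_pos.2 hM)]
  refine (h.isQuasimorphism hTK hS hδ.le hM).le_mul_homogenization
    (mul_le_epsteinFujiwara_pow (by positivity) (by linarith) hS.geodesic h.2.2 ?_
      (h.dist_le_pathCost_reverse hTK hS hδ hac hch))
  linarith [h.len_le hTK hS]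

theorem Admissible.ofReal_le_stableWordNorm {A : Set Γ} (hA : ∀ a ∈ A, a⁻¹ ∈ A) {C : ℝ}
    (hC : 0 < C)
    (hbound : ∀ a ∈ A, |homogenization (epsteinFujiwara w (K + 1) x : Γ → ℝ) a| ≤ C) :
    ENNReal.ofReal (1 / gapExponent δ T K R N / (C + 2 * gapDefect δ K)) ≤ stableWordNorm A g := by
  have hCE : 0 < C + 2 * gapDefect δ K := by
    linarith [gapDefect_nonneg hδ.le hTK.2.1.le]
  refine le_trans (ENNReal.ofReal_le_ofReal ?_) (ofReal_div_le_stableWordNorm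
    (h.isQuasimorphism hTK hS hδ.le (Nat.succ_pos _)) hA hbound hCE)
  gcongr
  exact (h.one_div_le_homogenization hTK hS hδ hac hch).trans (le_abs_self _)

end LowerBound

end Gap

end GapThm

end

theorem mainTheorem4 (δ : ℝ) (hδ : 0 < δ) :
    (∃ T K : ℝ, GapThm.DisplacementConstants.{u, v} δ T K) ∧
    ∀ T K : ℝ, GapThm.DisplacementConstants.{u, v} δ T K →
    ∀ (R : ℝ → ℝ) (N : ℝ → ℕ), ∃ M : ℕ, 0 < M ∧
    ∀ (Γ : Type u) [Group Γ] (S : Type v) [MetricSpace S] [Nonempty S] [MulAction Γ S]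
      [IsIsometricSMul Γ S],
      GapThm.IsHyperbolic δ S → GapThm.AcylindricalWith Γ S R N →
      (∀ g : Γ, GapThm.IsLoxodromic S g → ¬ GapThm.IsAchiral g →
        max T (2 * K + 2) ≤ GapThm.translationLength S (g ^ M) ∧
        ∀ (x₀ : S) (w : GapThm.ArcPath S), GapThm.Admissible δ T K M g x₀ w →
          1 / (M : ℝ) ≤
            GapThm.homogenization (GapThm.epsteinFujiwara w (K + 1) x₀ : Γ → ℝ) g) ∧
      ∀ A : Set Γ, (∀ a ∈ A, a⁻¹ ∈ A) → (∀ a : Γ, IsOfFinOrder a → a ∈ A) →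
      ∀ (x₀ : Γ → S) (w : Γ → GapThm.ArcPath S),
        (∀ g : Γ, GapThm.IsLoxodromic S g → ¬ GapThm.IsAchiral g →
          GapThm.Admissible δ T K M g (x₀ g) (w g)) →
      ∀ C : ℝ, 0 < C →
        (∀ g : Γ, GapThm.IsLoxodromic S g → ¬ GapThm.IsAchiral g → ∀ a ∈ A,
          |GapThm.homogenization (GapThm.epsteinFujiwara (w g) (K + 1) (x₀ g) : Γ → ℝ) a| ≤ C) →
        (∀ g : Γ, GapThm.IsLoxodromic S g →
          (GapThm.IsAchiral g ↔ GapThm.stableWordNorm A g = 0)) ∧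
        ∃ Θ : ℝ, 0 < Θ ∧ ∀ g : Γ, GapThm.IsLoxodromic S g → ¬ GapThm.IsAchiral g →
          ENNReal.ofReal Θ ≤ GapThm.stableWordNorm A g := by
  refine ⟨GapThm.exists_displacementConstants hδ, fun T K hTK R N =>
    ⟨GapThm.gapExponent δ T K R N, Nat.succ_pos _, fun Γ _ S _ _ _ _ hS hac => ⟨?_, ?_⟩⟩⟩
  · exact fun g hg hch => ⟨GapThm.max_le_translationLength_pow_gapExponent hTK hS hδ hac hg,
      fun x₀ w h => h.one_div_le_homogenization hTK hS hδ hac hch⟩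
  intro A hA hfin x₀ w hadm C hC hbound
  have hdefect := GapThm.gapDefect_nonneg hδ.le hTK.2.1.le
  have hM : 0 < (GapThm.gapExponent δ T K R N : ℝ) := Nat.cast_pos.2 (Nat.succ_pos _)
  set Θ := 1 / (GapThm.gapExponent δ T K R N : ℝ) / (C + 2 * GapThm.gapDefect δ K)
  have hΘ : 0 < Θ := by positivity
  have hgap (g : Γ) (hg : GapThm.IsLoxodromic S g) (hch : ¬ GapThm.IsAchiral g) :
      ENNReal.ofReal Θ ≤ GapThm.stableWordNorm A g :=
    (hadm g hg hch).ofReal_le_stableWordNorm hTK hS hδ hac hch hA hC (hbound g hg hch)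
  refine ⟨fun g hg => ⟨GapThm.stableWordNorm_eq_zero_of_isAchiral hTK hS hδ hac hA hfin hg,
    fun hzero => by_contra fun hch => ?_⟩, Θ, hΘ, hgap⟩
  exact ((ENNReal.ofReal_pos.2 hΘ).trans_le (hgap g hg hch)).ne' hzero
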